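/- For a complex matrix or vector $M$ let $M'$ denote its conjugate transpose, and let $|\cdot|$ denote the Euclidean norm on $\mathbb C^m$. Let $A\in\mathbb C^{n\times n}$ and $B\in\mathbb C^{n\times m}$, and assume that the pair $(A,B)$ is stabilizable in discrete time: there exists $K\in\mathbb C^{m\times n}$ such that $zI_n-A-BK$ is invertible for all $z\in\mathbb C$ with $|z|\ge 1$. Let $Q=Q'\in\mathbb C^{(n+m)\times(n+m)}$, and put $$\sigma(x,u)=\begin{bmatrix}x\\u\end{bmatrix}'Q\begin{bmatrix}x\\u\end{bmatrix}\qquad(x\in\mathbb C^n,\ u\in\mathbb C^m).$$ Then the following conditions are equivalent: (a) there exist matrices $P=P'\in\mathbb C^{n\times n}$, $C\in\mathbb C^{m\times n}$ and $D\in\mathbb C^{m\times m}$ such that $$\sigma(x,u)+x'Px-(Ax+Bu)'P(Ax+Bu)=|Cx+Du|^2\quad\text{for all }x\in\mathbb C^n,\ u\in\mathbb C^m,$$ and $$\det\begin{bmatrix}\lambda A-I_n&\lambda B\\ C&D\end{bmatrix}\ne 0\quad\text{for all }\lambda\in\mathbb C\text{ with }|\lambda|<1;$$ (b) the matrix $$\Pi(z)=\begin{bmatrix}(zI_n-A)^{-1}B\\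 I_m\end{bmatrix}'Q\begin{bmatrix}(zI_n-A)^{-1}B\\ I_m\end{bmatrix},$$ defined for those $z\in\mathbb C$ with $\det(zI_n-A)\neq0$, is defined and positive definite for all $z$ on the unit circle $\{z\in\mathbb C:|z|=1\}$ except, possibly, for finitely many $z$. Moreover, if $A$, $B$, $Q$ are real and (b) holds, then the matrices $P$, $C$, $D$ in (a) can be chosen to be real as well. -/

import Mathlib

open scoped Matrix ComplexOrder

noncomputable section

namespace KYP

variable {n m : ℕ}

/-- Discrete-time stabilizability of the pair `(A, B)`: for some feedback gain `K`, the matrix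
`z I - A - B K` is invertible for every complex `z` with `|z| ≥ 1`. -/
def Stabilizable (A : Matrix (Fin n) (Fin n) ℂ) (B : Matrix (Fin n) (Fin m) ℂ) : Prop :=
  ∃ K : Matrix (Fin m) (Fin n) ℂ,
    ∀ z : ℂ, 1 ≤ ‖z‖ → IsUnit (z • (1 : Matrix (Fin n) (Fin n) ℂ) - A - B * K)

/-- The form `v' M v`, where `v'` is the conjugate transpose of `v`. For Hermitian `M` its values
are real complex numbers. -/
def form {ι : Type*} [Fintype ι] (M : Matrix ι ι ℂ) (v : ι → ℂ) : ℂ :=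
  star v ⬝ᵥ (M *ᵥ v)

/-- The form `σ(x, u) = [x; u]' Q [x; u]`. -/
def sigma (Q : Matrix (Fin n ⊕ Fin m) (Fin n ⊕ Fin m) ℂ) (x : Fin n → ℂ) (u : Fin m → ℂ) : ℂ :=
  form Q (Sum.elim x u)

/-- `(P, C, D)` is a stabilizing completion of squares for `(A, B, Q)`. The vector norm is the
Euclidean one. -/
structure IsStabilizingCompletion
    (A : Matrix (Fin n) (Fin n) ℂ) (B : Matrix (Fin n) (Fin m) ℂ)
    (Q : Matrix (Fin n ⊕ Fin m) (Fin n ⊕ Fin m) ℂ)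
    (P : Matrix (Fin n) (Fin n) ℂ) (C : Matrix (Fin m) (Fin n) ℂ)
    (D : Matrix (Fin m) (Fin m) ℂ) : Prop where
  isHermitian : P.IsHermitian
  completion : ∀ (x : Fin n → ℂ) (u : Fin m → ℂ),
    sigma Q x u + form P x - form P (A *ᵥ x + B *ᵥ u) =
      ((‖WithLp.toLp 2 (C *ᵥ x + D *ᵥ u)‖ ^ 2 : ℝ) : ℂ)
  det_ne_zero : ∀ l : ℂ, ‖l‖ < 1 →
    (Matrix.fromBlocks (l • A - 1) (l • B) C D).det ≠ 0

/-- `Π(z) = [(z I - A)⁻¹ B; I]' Q [(z I - A)⁻¹ B; I]`, meaningful when `det (z I - A) ≠ 0`. -/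
def Pi (A : Matrix (Fin n) (Fin n) ℂ) (B : Matrix (Fin n) (Fin m) ℂ)
    (Q : Matrix (Fin n ⊕ Fin m) (Fin n ⊕ Fin m) ℂ) (z : ℂ) : Matrix (Fin m) (Fin m) ℂ :=
  (Matrix.fromRows ((z • (1 : Matrix (Fin n) (Fin n) ℂ) - A)⁻¹ * B)
      (1 : Matrix (Fin m) (Fin m) ℂ))ᴴ * Q *
    Matrix.fromRows ((z • (1 : Matrix (Fin n) (Fin n) ℂ) - A)⁻¹ * B)
      (1 : Matrix (Fin m) (Fin m) ℂ)

/-- For all but finitely many `z` on the unit circle, `Π(z)` is defined and positive definite. -/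
def FrequencyCondition (A : Matrix (Fin n) (Fin n) ℂ) (B : Matrix (Fin n) (Fin m) ℂ)
    (Q : Matrix (Fin n ⊕ Fin m) (Fin n ⊕ Fin m) ℂ) : Prop :=
  {z : ℂ | ‖z‖ = 1 ∧
    ¬ ((z • (1 : Matrix (Fin n) (Fin n) ℂ) - A).det ≠ 0 ∧ (Pi A B Q z).PosDef)}.Finite

/-- All entries of the complex matrix `M` are real. -/
def IsRealMatrix {ι κ : Type*} (M : Matrix ι κ ℂ) : Prop :=
  ∀ i j, (M i j).im = 0

end KYP

end

/-! Along a harmonic motion, that is `A x + B u = z x` with `|z| = 1`, the two terms in `P` cancel,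
so a completion of squares gives `σ(x,u) = |C x + D u|²`. A nonzero motion with zero output makes
the system determinant vanish at `z⁻¹`. This determinant is a polynomial in `λ`, nonzero at `0`, so
only finitely many frequencies are lost. This is (a) ⇒ (b).

For (b) ⇒ (a), a stabilizing feedback `u = K x + v` reduces to stable `A`; continuity then makes `σ`
nonnegative along harmonic motions of every frequency on the circle. Suppose first that it is
strictly positive along all nonzero ones. A stationary covariance `H ≥ 0` splits into harmonic
motions, because two matrices with equal row Gram matrices differ by a unitary factor, which can be
diagonalised (`exists_unitary_diagonal`). Hence no nonzero `H` has cost `tr (Q H) ≤ 0`, and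
Hahn-Banach separation yields a `P` making `σ + x'Px - (Ax+Bu)'P(Ax+Bu)` positive definite
(`exists_kyp_posDef`). With this as running cost, the regulator problem is solved by a subsolution
of maximal trace: it satisfies the Riccati equation, and its square has no zeros in the closed disc
(`exists_regulator`).

In general `σ` is perturbed to `σ + ε|u|²`, and the difficulty is to bound the resulting `P_k`. A
Lyapunov equation makes the state block of `Q` zero, so that `P_k ≥ 0`. The vectors on which the
`P_k` stay bounded form an `A`-invariant subspace containing the image of `B`. Were it proper, there
would be an eigenvector `v` of `A` modulo it, with eigenvalue `a`, `|a| < 1`. Pairing `C_k v` with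
the response of the system at `λ = conj a` bounds `C_k v`; the dissipation identity then bounds
`P_k` at `v`, a contradiction (`boundedSubspace_eq_top`). The responses used are uniformly bounded
by a quantitative Hurwitz theorem (`norm_eval_lower_bound`), which also keeps the zeros of the limit
out of the open disc.

Each construction (feedback, Lyapunov solution, multiplier, regulator, limit) is arranged to give
real matrices for real data. -/

namespace KYP

/-! ### Sesquilinear and Hermitian forms of complex matrices. -/

section Sesquilinear

variable {ι κ : Type*} [Fintype ι] [Fintype κ]

/-- The sesquilinear form `v' M w`. -/
def sesq (M : Matrix ι κ ℂ) (v : ι → ℂ) (w : κ → ℂ) : ℂ := star v ⬝ᵥ (M *ᵥ w)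

theorem form_eq_sesq (M : Matrix ι ι ℂ) (v : ι → ℂ) : form M v = sesq M v v := rfl

theorem sesq_add_left (M : Matrix ι κ ℂ) (v₁ v₂ : ι → ℂ) (w : κ → ℂ) :
    sesq M (v₁ + v₂) w = sesq M v₁ w + sesq M v₂ w := by
  simp [sesq, add_dotProduct]

theorem sesq_add_right (M : Matrix ι κ ℂ) (v : ι → ℂ) (w₁ w₂ : κ → ℂ) :
    sesq M v (w₁ + w₂) = sesq M v w₁ + sesq M v w₂ := by
  simp [sesq, Matrix.mulVec_add, dotProduct_add]

theorem sesq_smul_left (M : Matrix ι κ ℂ) (c : ℂ) (v : ι → ℂ) (w : κ → ℂ) :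
    sesq M (c • v) w = star c * sesq M v w := by
  simp [sesq]

theorem sesq_smul_right (M : Matrix ι κ ℂ) (c : ℂ) (v : ι → ℂ) (w : κ → ℂ) :
    sesq M v (c • w) = c * sesq M v w := by
  simp [sesq, Matrix.mulVec_smul]

theorem sesq_add (M N : Matrix ι κ ℂ) (v : ι → ℂ) (w : κ → ℂ) :
    sesq (M + N) v w = sesq M v w + sesq N v w := by
  simp [sesq, Matrix.add_mulVec, dotProduct_add]

theorem sesq_sub (M N : Matrix ι κ ℂ) (v : ι → ℂ) (w : κ → ℂ) :
    sesq (M - N) v w = sesq M v w - sesq N v w := by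
  simp [sesq, Matrix.sub_mulVec, dotProduct_sub]

theorem sesq_neg (M : Matrix ι κ ℂ) (v : ι → ℂ) (w : κ → ℂ) :
    sesq (-M) v w = -sesq M v w := by
  simp [sesq, Matrix.neg_mulVec]

theorem sesq_smul (c : ℂ) (M : Matrix ι κ ℂ) (v : ι → ℂ) (w : κ → ℂ) :
    sesq (c • M) v w = c * sesq M v w := by
  simp [sesq, Matrix.smul_mulVec]

theorem sesq_congr {ι' κ' : Type*} [Fintype ι'] [Fintype κ'] (S : Matrix ι ι' ℂ)
    (M : Matrix ι κ ℂ) (T : Matrix κ κ' ℂ) (v : ι' → ℂ) (w : κ' → ℂ) :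
    sesq (Sᴴ * M * T) v w = sesq M (S *ᵥ v) (T *ᵥ w) := by
  simp only [sesq, ← Matrix.mulVec_mulVec, Matrix.star_mulVec, Matrix.dotProduct_mulVec]

theorem sesq_gram {ι' : Type*} [Fintype ι'] (S : Matrix ι ι' ℂ) (T : Matrix ι κ ℂ)
    (v : ι' → ℂ) (w : κ → ℂ) :
    sesq (Sᴴ * T) v w = star (S *ᵥ v) ⬝ᵥ (T *ᵥ w) := by
  simp only [sesq, ← Matrix.mulVec_mulVec, Matrix.star_mulVec, Matrix.dotProduct_mulVec]

theorem star_dotProduct_self (v : ι → ℂ) :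
    star v ⬝ᵥ v = ((∑ i, ‖v i‖ ^ 2 : ℝ) : ℂ) := by
  simp [dotProduct, ← Complex.conj_mul']

theorem star_dotProduct_self_re (v : ι → ℂ) : (star v ⬝ᵥ v).re = ∑ i, ‖v i‖ ^ 2 := by
  rw [star_dotProduct_self, Complex.ofReal_re]

theorem star_dotProduct_self_eq_norm (v : ι → ℂ) :
    star v ⬝ᵥ v = ((‖WithLp.toLp 2 v‖ ^ 2 : ℝ) : ℂ) := by
  rw [star_dotProduct_self, EuclideanSpace.norm_sq_eq]

theorem star_sesq (M : Matrix ι κ ℂ) (v : ι → ℂ) (w : κ → ℂ) :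
    star (sesq M v w) = sesq Mᴴ w v := by
  rw [sesq, sesq, Matrix.star_dotProduct, Matrix.star_mulVec, Matrix.dotProduct_mulVec]
  simp [dotProduct_comm]

theorem sesq_single [DecidableEq ι] [DecidableEq κ] (M : Matrix ι κ ℂ) (i : ι) (j : κ) :
    sesq M (Pi.single i 1) (Pi.single j 1) = M i j := by
  rw [sesq, Matrix.mulVec_single_one, ← Pi.single_star, star_one, single_one_dotProduct]
  rfl

theorem ext_sesq {M N : Matrix ι κ ℂ} (h : ∀ v w, sesq M v w = sesq N v w) : M = N := by
  classical
  ext i j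
  rw [← sesq_single M, h, sesq_single]

/-- Polarization: the values at `v + w` and `v + i w` recover the sesquilinear form. -/
theorem ext_form {M N : Matrix ι ι ℂ} (h : ∀ v, form M v = form N v) : M = N := by
  refine ext_sesq fun v w => ?_
  have h1 := h (v + w)
  have h2 := h (v + Complex.I • w)
  have hv := h v
  have hw := h w
  simp only [form_eq_sesq, sesq_add_left, sesq_add_right, sesq_smul_left, sesq_smul_right] at *
  simp only [Complex.star_def, Complex.conj_I] at h2
  have hI : Complex.I * Complex.I = -1 := Complex.I_mul_I
  linear_combination (1 / 2 : ℂ) * h1 - (1 / 2 : ℂ) * (1 - Complex.I) * hv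
    - (1 / 2 : ℂ) * (1 - Complex.I) * hw - (1 / 2 : ℂ) * Complex.I * h2
    + (1 / 2 : ℂ) * (sesq M v w + sesq N w v - sesq N v w + Complex.I * sesq N w w
      - Complex.I * sesq M w w - sesq M w v) * hI


theorem form_im_eq_zero {M : Matrix ι ι ℂ} (hM : M.IsHermitian) (v : ι → ℂ) :
    (form M v).im = 0 := by
  have h := star_sesq M v v
  rw [hM.eq] at h
  exact Complex.conj_eq_iff_im.mp h

theorem posSemidef_iff_re {M : Matrix ι ι ℂ} :
    M.PosSemidef ↔ M.IsHermitian ∧ ∀ v, 0 ≤ (form M v).re := by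
  rw [Matrix.posSemidef_iff_dotProduct_mulVec]
  refine and_congr_right fun hM => forall_congr' fun v => ?_
  change 0 ≤ form M v ↔ _
  rw [Complex.nonneg_iff]
  simp [form_im_eq_zero hM]

theorem posDef_iff_re {M : Matrix ι ι ℂ} :
    M.PosDef ↔ M.IsHermitian ∧ ∀ v, v ≠ 0 → 0 < (form M v).re := by
  rw [Matrix.posDef_iff_dotProduct_mulVec]
  refine and_congr_right fun hM => forall_congr' fun v => imp_congr_right fun _ => ?_
  change 0 < form M v ↔ _
  rw [Complex.pos_iff]
  simp [form_im_eq_zero hM]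

theorem form_add_vec_re {M : Matrix ι ι ℂ} (hM : M.IsHermitian) (v w : ι → ℂ) :
    (form M (v + w)).re = (form M v).re + (form M w).re + 2 * (sesq M v w).re := by
  have h := congrArg Complex.re (star_sesq M v w)
  rw [hM.eq] at h
  simp only [Complex.star_def, Complex.conj_re] at h
  simp only [form_eq_sesq, sesq_add_left, sesq_add_right, Complex.add_re]
  linarith

theorem form_smul_vec_re (M : Matrix ι ι ℂ) (c : ℂ) (v : ι → ℂ) :
    (form M (c • v)).re = ‖c‖ ^ 2 * (form M v).re := by
  rw [form_eq_sesq, form_eq_sesq, sesq_smul_left, sesq_smul_right, ← mul_assoc, Complex.star_def,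
    Complex.conj_mul', ← Complex.ofReal_pow, Complex.re_ofReal_mul]

/-- Expand the nonnegative value at `v + c w`, with `c` unimodular and chosen to rotate the cross
term to the negative real axis. -/
theorem norm_sesq_le {M : Matrix ι ι ℂ} (hM : M.PosSemidef) (v w : ι → ℂ) :
    2 * ‖sesq M v w‖ ≤ (form M v).re + (form M w).re := by
  obtain ⟨hH, hn⟩ := posSemidef_iff_re.mp hM
  rcases eq_or_ne (sesq M v w) 0 with h0 | h0
  · rw [h0, norm_zero]
    linarith [hn v, hn w]
  · have hpos : 0 < ‖sesq M v w‖ := norm_pos_iff.mpr h0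
    set c : ℂ := -(star (sesq M v w) / ‖sesq M v w‖) with hc
    have hcn : ‖c‖ = 1 := by
      rw [hc, norm_neg, norm_div, norm_star, Complex.norm_real, norm_norm, div_self hpos.ne']
    have key : c * sesq M v w = ((-‖sesq M v w‖ : ℝ) : ℂ) := by
      have h2 := Complex.conj_mul' (sesq M v w)
      have h3 : (‖sesq M v w‖ : ℂ) ≠ 0 := by exact_mod_cast hpos.ne'
      rw [hc, Complex.star_def]
      field_simp
      rw [h2]
      push_cast
      ring
    have h := hn (v + c • w)
    rw [form_add_vec_re hH, sesq_smul_right, key, form_smul_vec_re, hcn, Complex.ofReal_re] at h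
    linarith

theorem continuous_form (v : ι → ℂ) : Continuous fun M : Matrix ι ι ℂ => form M v := by
  unfold form
  fun_prop

end Sesquilinear

/-! ### Matrices with real entries. -/

section Real

variable {ι κ μ : Type*}

theorem isRealMatrix_iff_map {M : Matrix ι κ ℂ} :
    IsRealMatrix M ↔ M.map (starRingEnd ℂ) = M := by
  simp only [IsRealMatrix, ← Matrix.ext_iff, Matrix.map_apply, Complex.conj_eq_iff_im]

theorem IsRealMatrix.add {M N : Matrix ι κ ℂ} (hM : IsRealMatrix M) (hN : IsRealMatrix N) :
    IsRealMatrix (M + N) := fun i j => by simp [hM i j, hN i j]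

theorem IsRealMatrix.sub {M N : Matrix ι κ ℂ} (hM : IsRealMatrix M) (hN : IsRealMatrix N) :
    IsRealMatrix (M - N) := fun i j => by simp [hM i j, hN i j]

theorem IsRealMatrix.neg {M : Matrix ι κ ℂ} (hM : IsRealMatrix M) :
    IsRealMatrix (-M) := fun i j => by simp [hM i j]

theorem IsRealMatrix.smul {M : Matrix ι κ ℂ} (hM : IsRealMatrix M) (c : ℝ) :
    IsRealMatrix ((c : ℂ) • M) := fun i j => by simp [hM i j]

theorem IsRealMatrix.zero : IsRealMatrix (0 : Matrix ι κ ℂ) := fun _ _ => rfl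

theorem IsRealMatrix.one [DecidableEq ι] : IsRealMatrix (1 : Matrix ι ι ℂ) := fun i j => by
  rw [Matrix.one_apply]
  split_ifs <;> simp

theorem IsRealMatrix.mul [Fintype κ] {M : Matrix ι κ ℂ} {N : Matrix κ μ ℂ}
    (hM : IsRealMatrix M) (hN : IsRealMatrix N) : IsRealMatrix (M * N) := fun i j => by
  simp [Matrix.mul_apply, Complex.mul_im, hM i _, hN _ j]

theorem IsRealMatrix.conjTranspose {M : Matrix ι κ ℂ} (hM : IsRealMatrix M) :
    IsRealMatrix Mᴴ := fun i j => by simp [hM j i]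

theorem IsRealMatrix.fromCols {M : Matrix ι κ ℂ} {N : Matrix ι μ ℂ}
    (hM : IsRealMatrix M) (hN : IsRealMatrix N) : IsRealMatrix (Matrix.fromCols M N)
  | i, Sum.inl j => hM i j
  | i, Sum.inr j => hN i j

theorem IsRealMatrix.submatrix {ι' κ' : Type*} {M : Matrix ι κ ℂ} (hM : IsRealMatrix M)
    (f : ι' → ι) (g : κ' → κ) : IsRealMatrix (M.submatrix f g) := fun i j => hM (f i) (g j)

theorem IsRealMatrix.inv [Fintype ι] [DecidableEq ι] {M : Matrix ι ι ℂ} (hM : IsRealMatrix M)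
    (hu : IsUnit M.det) : IsRealMatrix M⁻¹ := by
  rw [isRealMatrix_iff_map] at hM ⊢
  refine (Matrix.inv_eq_right_inv ?_).symm
  nth_rewrite 1 [← hM]
  rw [← Matrix.map_mul, Matrix.mul_nonsing_inv _ hu, Matrix.map_one _ (map_zero _) (map_one _)]

theorem isClosed_isRealMatrix : IsClosed {M : Matrix ι κ ℂ | IsRealMatrix M} := by
  simp only [IsRealMatrix, Set.ofPred_forall]
  refine isClosed_iInter fun i => isClosed_iInter fun j => ?_
  exact isClosed_eq (by fun_prop) continuous_const

open scoped MatrixOrder in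
/-- A positive definite matrix has a square factor, which may be taken real if the matrix is. -/
theorem exists_gram_factor [Fintype ι] {M : Matrix ι ι ℂ} (hM : M.PosDef) :
    ∃ D : Matrix ι ι ℂ, Dᴴ * D = M ∧ (IsRealMatrix M → IsRealMatrix D) := by
  classical
  by_cases hr : IsRealMatrix M
  · have hMN : (M.map Complex.re).map Complex.ofReal = M := by
      ext i j
      exact Complex.ext rfl (by simp [hr i j])
    -- In the real case the factorization is taken over the reals, so that the factor is real.
    have hN : (M.map Complex.re).PosSemidef := by
      rw [Matrix.posSemidef_iff_dotProduct_mulVec]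
      constructor
      · ext i j
        have := congrFun (congrFun hM.1 i) j
        simpa using congrArg Complex.re this
      · intro x
        have h := (posSemidef_iff_re.mp hM.posSemidef).2 (fun i => (x i : ℂ))
        have he : star x ⬝ᵥ M.map Complex.re *ᵥ x = (form M fun i => (x i : ℂ)).re := by
          simp [form, dotProduct, Matrix.mulVec]
        rwa [he]
    obtain ⟨D, hD⟩ := CStarAlgebra.nonneg_iff_eq_star_mul_self.mp hN.nonneg
    refine ⟨D.map Complex.ofReal, ?_, fun _ i j => by simp⟩
    rw [← hMN, hD]
    ext i j
    simp [Matrix.mul_apply]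
  · obtain ⟨D, hD⟩ := CStarAlgebra.nonneg_iff_eq_star_mul_self.mp hM.posSemidef.nonneg
    exact ⟨D, hD.symm, fun h => absurd h hr⟩

end Real

/-! ### Powers of stable matrices and the Lyapunov equation. -/

section Powers

open Filter Topology

variable {ι : Type*} [Fintype ι] [DecidableEq ι]

/-- Discrete-time stability: every eigenvalue has modulus less than one. -/
def Stable (A : Matrix ι ι ℂ) : Prop :=
  ∀ z : ℂ, 1 ≤ ‖z‖ → IsUnit (z • (1 : Matrix ι ι ℂ) - A)

open scoped Matrix.Norms.Operator in
-- The spectral radius is below one, so by Gelfand's formula the norms of the powers are eventually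
-- below a geometric sequence.
theorem Stable.tendsto_pow_apply {A : Matrix ι ι ℂ} (hA : Stable A) (i j : ι) :
    Tendsto (fun t : ℕ => (A ^ t) i j) atTop (𝓝 0) := by
  have : Nonempty ι := ⟨i⟩
  have hlt : spectralRadius ℂ A < (1 : NNReal) := by
    refine spectrum.spectralRadius_lt_of_forall_lt A fun z hz => ?_
    by_contra hcon
    refine hz ?_
    have h := hA z (by exact_mod_cast not_lt.mp hcon)
    rwa [spectrum.mem_resolventSet_iff, Algebra.algebraMap_eq_smul_one]
  obtain ⟨r, hr, hr1⟩ := ENNReal.lt_iff_exists_nnreal_btwn.mp hlt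
  have hr1' : r < 1 := by exact_mod_cast hr1
  have hev := (spectrum.pow_nnnorm_pow_one_div_tendsto_nhds_spectralRadius A).eventually_lt_const hr
  refine squeeze_zero_norm' ?_ (tendsto_pow_atTop_nhds_zero_of_lt_one r.2 hr1')
  filter_upwards [hev, eventually_gt_atTop 0] with t ht ht0
  have h1 : (‖A ^ t‖₊ : ENNReal) ≤ (r : ENNReal) ^ t := by
    have h2 := ENNReal.rpow_le_rpow ht.le (Nat.cast_nonneg t)
    rwa [← ENNReal.rpow_mul, one_div, inv_mul_cancel₀ (by positivity), ENNReal.rpow_one,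
      ENNReal.rpow_natCast] at h2
  have h3 : ‖A ^ t‖₊ ≤ r ^ t := by exact_mod_cast h1
  have h4 : ‖(A ^ t) i j‖₊ ≤ ‖A ^ t‖₊ := by
    rw [Matrix.linfty_opNNNorm_def]
    exact (Finset.single_le_sum (f := fun j => ‖(A ^ t) i j‖₊) (fun _ _ => zero_le)
      (Finset.mem_univ j)).trans (Finset.le_sup (f := fun i => ∑ j, ‖(A ^ t) i j‖₊)
        (Finset.mem_univ i))
  exact_mod_cast h4.trans h3

theorem Stable.tendsto_pow_mulVec {A : Matrix ι ι ℂ} (hA : Stable A) (v : ι → ℂ) :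
    Tendsto (fun t : ℕ => (A ^ t) *ᵥ v) atTop (𝓝 0) := by
  refine tendsto_pi_nhds.mpr fun i => ?_
  have : Tendsto (fun t : ℕ => ∑ j, (A ^ t) i j * v j) atTop (𝓝 (∑ j, 0 * v j)) :=
    tendsto_finsetSum _ fun j _ => (hA.tendsto_pow_apply i j).mul_const _
  simpa [Matrix.mulVec, dotProduct] using this

theorem Stable.tendsto_form {A : Matrix ι ι ℂ} (hA : Stable A) (P : Matrix ι ι ℂ) (v : ι → ℂ) :
    Tendsto (fun t : ℕ => (form P ((A ^ t) *ᵥ v)).re) atTop (𝓝 0) := by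
  have hc : Continuous fun w : ι → ℂ => (form P w).re := by
    unfold form
    fun_prop
  have h := (hc.tendsto 0).comp (hA.tendsto_pow_mulVec v)
  simpa [form, Function.comp_def] using h

theorem Stable.eq_zero_of_mulVec_eq {A : Matrix ι ι ℂ} (hA : Stable A) {z : ℂ} (hz : 1 ≤ ‖z‖)
    {v : ι → ℂ} (hv : A *ᵥ v = z • v) : v = 0 := by
  have h := hA z hz
  have h0 : (z • (1 : Matrix ι ι ℂ) - A) *ᵥ v = 0 := by
    simp [Matrix.sub_mulVec, Matrix.smul_mulVec, hv]
  exact (Matrix.mulVec_injective_iff_isUnit.mpr h) (by simpa using h0)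

/-- A form which does not increase under pullback by a stable matrix is nonnegative. -/
theorem Stable.form_nonneg {A : Matrix ι ι ℂ} (hA : Stable A) {P : Matrix ι ι ℂ}
    (h : ∀ v, (form P (A *ᵥ v)).re ≤ (form P v).re) (v : ι → ℂ) : 0 ≤ (form P v).re := by
  have hle : ∀ t : ℕ, (form P ((A ^ t) *ᵥ v)).re ≤ (form P v).re := by
    intro t
    induction t with
    | zero => simp
    | succ t ih =>
      rw [pow_succ', ← Matrix.mulVec_mulVec]
      exact (h _).trans ih
  exact le_of_tendsto' (hA.tendsto_form P v) hle

/-- The form of `R` is constant along `A ^ t v`, which tends to zero. -/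
theorem Stable.eq_zero_of_eq_congr {A : Matrix ι ι ℂ} (hA : Stable A) {R : Matrix ι ι ℂ}
    (h : R = Aᴴ * R * A) : R = 0 := by
  refine ext_form fun v => ?_
  have hstep : ∀ t : ℕ, form R ((A ^ t) *ᵥ v) = form R v := by
    intro t
    induction t with
    | zero => simp
    | succ t ih =>
      rw [pow_succ', ← Matrix.mulVec_mulVec, form_eq_sesq, ← sesq_congr, ← h]
      exact ih
  have hc : Continuous fun w : ι → ℂ => form R w := by
    unfold form
    fun_prop
  have h1 := (hc.tendsto 0).comp (hA.tendsto_pow_mulVec v)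
  simp only [Function.comp_def, hstep] at h1
  exact (tendsto_nhds_unique tendsto_const_nhds h1).trans (by simp [form])

/-- The discrete Lyapunov equation of a stable matrix is solvable. -/
theorem Stable.exists_lyapunov {A : Matrix ι ι ℂ} (hA : Stable A) {Q : Matrix ι ι ℂ}
    (hQ : Q.IsHermitian) :
    ∃ R : Matrix ι ι ℂ, R - Aᴴ * R * A = Q ∧ R.IsHermitian ∧
      (IsRealMatrix A → IsRealMatrix Q → IsRealMatrix R) := by
  let T : Matrix ι ι ℂ →ₗ[ℂ] Matrix ι ι ℂ :=
    { toFun := fun R => R - Aᴴ * R * A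
      map_add' := fun R S => by rw [Matrix.mul_add, Matrix.add_mul]; abel
      map_smul' := fun c R => by simp [smul_sub] }
  have hinj : Function.Injective T := by
    refine (injective_iff_map_eq_zero T).mpr fun R hR => ?_
    exact hA.eq_zero_of_eq_congr (sub_eq_zero.mp hR)
  obtain ⟨R, hR⟩ := LinearMap.injective_iff_surjective.mp hinj Q
  have hR' : R - Aᴴ * R * A = Q := hR
  refine ⟨R, hR', ?_, fun hAr hQr => ?_⟩
  -- `Rᴴ`, and below the entrywise conjugate of `R` for real data, solves the same equation;
  -- uniqueness identifies it with `R`.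
  · refine hinj ?_
    change Rᴴ - Aᴴ * Rᴴ * A = T R
    rw [hR]
    rw [← hQ.eq, ← hR']
    simp [Matrix.mul_assoc]
  · have hAH := isRealMatrix_iff_map.mp hAr.conjTranspose
    rw [isRealMatrix_iff_map] at *
    refine hinj ?_
    change R.map (starRingEnd ℂ) - Aᴴ * R.map (starRingEnd ℂ) * A = T R
    rw [hR]
    rw [← hQr, ← hR', Matrix.map_sub _ (map_sub _), Matrix.map_mul, Matrix.map_mul, hAH, hAr]

end Powers

/-! ### Isometries and pairs of matrices with equal Gram matrices. -/

section Unitary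

open Module

/-- A linear isometry of a finite-dimensional complex inner product space has an orthonormal basis
of eigenvectors. -/
theorem exists_orthonormalBasis_eigenvectors {E : Type*} [NormedAddCommGroup E]
    [InnerProductSpace ℂ E] [FiniteDimensional ℂ E] (U : E →ₗᵢ[ℂ] E) :
    ∃ b : OrthonormalBasis (Fin (finrank ℂ E)) ℂ E, ∀ i, ∃ z : ℂ, ‖z‖ = 1 ∧ U (b i) = z • b i := by
  classical
  set T : End ℂ E := U.toLinearMap with hT
  have hnorm : ∀ {μ : ℂ} {v : E}, v ≠ 0 → U v = μ • v → ‖μ‖ = 1 := fun {μ v} hv h => by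
    have h1 := U.norm_map v
    rw [h, norm_smul] at h1
    exact mul_right_cancel₀ (norm_ne_zero_iff.mpr hv) (h1.trans (one_mul _).symm)
  have hshift : ∀ {μ : ℂ} {v : E}, U v = μ • v → v ≠ 0 → ∀ w, starRingEnd ℂ μ * inner ℂ v (U w)
      = inner ℂ v w := fun {μ v} h _ w => by
    rw [← inner_smul_left, ← h, U.inner_map_map]
  have horth : OrthogonalFamily ℂ (fun μ : ℂ => End.eigenspace T μ)
      fun μ => (End.eigenspace T μ).subtypeₗᵢ := by
    refine OrthogonalFamily.of_pairwise fun ν μ hμν w hw v hv => ?_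
    rcases eq_or_ne w 0 with rfl | hw0
    · simp
    rcases eq_or_ne v 0 with rfl | hv0
    · simp
    have hv' : U v = μ • v := End.mem_eigenspace_iff.mp hv
    have hw' : U w = ν • w := End.mem_eigenspace_iff.mp hw
    have h1 := hshift hv' hv0 w
    rw [hw', inner_smul_right] at h1
    have hμ := hnorm hv0 hv'
    by_contra hne
    have h2 : starRingEnd ℂ μ * ν = 1 := by
      refine mul_right_cancel₀ hne ?_
      rw [mul_assoc, h1, one_mul]
    have h3 : μ * starRingEnd ℂ μ = 1 := by
      rw [Complex.mul_conj', hμ]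
      norm_num
    exact hμν (by linear_combination μ * h2 - ν * h3)
  -- The orthogonal complement of the eigenspaces is invariant; if nonzero it would contain an
  -- eigenvector.
  have htop : (⨆ μ, End.eigenspace T μ)ᗮ = ⊥ := by
    set W := (⨆ μ, End.eigenspace T μ)ᗮ with hW
    by_contra hne
    have hinv : ∀ w ∈ W, T w ∈ W := by
      intro w hw
      rw [hW, ← Submodule.iInf_orthogonal, Submodule.mem_iInf] at hw ⊢
      intro μ
      rw [Submodule.mem_orthogonal]
      intro v hv
      rcases eq_or_ne v 0 with rfl | hv0
      · simp
      have hv' : U v = μ • v := End.mem_eigenspace_iff.mp hv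
      have h1 := hshift hv' hv0 w
      rw [(Submodule.mem_orthogonal _ _).mp (hw μ) v hv] at h1
      refine (mul_eq_zero.mp h1).resolve_left ?_
      refine norm_ne_zero_iff.mp ?_
      rw [RCLike.norm_conj, hnorm hv0 hv']
      exact one_ne_zero
    have : Nontrivial W := Submodule.nontrivial_iff_ne_bot.mpr hne
    obtain ⟨μ, hμ⟩ := End.exists_eigenvalue (T.restrict hinv)
    obtain ⟨w, hw⟩ := hμ.exists_hasEigenvector
    have hw1 : T w = μ • (w : E) := congrArg Subtype.val hw.apply_eq_smul
    have hmem : (w : E) ∈ ⨆ μ, End.eigenspace T μ :=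
      Submodule.mem_iSup_of_mem μ (End.mem_eigenspace_iff.mpr hw1)
    have := (Submodule.mem_orthogonal _ _).mp w.2 w hmem
    exact hw.2 (Subtype.ext (inner_self_eq_zero.mp this))
  have hint : DirectSum.IsInternal fun μ : End.Eigenvalues T => End.eigenspace T μ := by
    have h' : OrthogonalFamily ℂ (fun μ : End.Eigenvalues T => End.eigenspace T μ)
      fun μ => (End.eigenspace T μ).subtypeₗᵢ := horth.comp Subtype.coe_injective
    refine h'.isInternal_iff.mpr ?_
    change (⨆ μ : { μ // End.eigenspace T μ ≠ ⊥ }, End.eigenspace T μ)ᗮ = ⊥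
    rw [iSup_ne_bot_subtype, htop]
  have h' : OrthogonalFamily ℂ (fun μ : End.Eigenvalues T => End.eigenspace T μ)
      fun μ => (End.eigenspace T μ).subtypeₗᵢ := horth.comp Subtype.coe_injective
  refine ⟨hint.subordinateOrthonormalBasis rfl h', fun i => ?_⟩
  have hmem := hint.subordinateOrthonormalBasis_subordinate rfl i h'
  have hv := End.mem_eigenspace_iff.mp hmem
  exact ⟨_, hnorm ((hint.subordinateOrthonormalBasis rfl h').orthonormal.ne_zero i) hv, hv⟩

variable {ι κ : Type*} [Fintype ι] [Fintype κ] [DecidableEq κ]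

/-- Two matrices with the same Gram matrix of rows differ by a unitary factor, which is
diagonalised here. -/
theorem exists_unitary_diagonal {X Y : Matrix ι κ ℂ} (h : X * Xᴴ = Y * Yᴴ) :
    ∃ (V : Matrix κ κ ℂ) (d : κ → ℂ), V * Vᴴ = 1 ∧ (∀ i, ‖d i‖ = 1) ∧
      Y * V = X * V * Matrix.diagonal d := by
  classical
  let f : (ι → ℂ) →ₗ[ℂ] EuclideanSpace ℂ κ :=
    (WithLp.linearEquiv 2 ℂ (κ → ℂ)).symm.toLinearMap ∘ₗ Xᴴ.mulVecLin
  let g : (ι → ℂ) →ₗ[ℂ] EuclideanSpace ℂ κ :=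
    (WithLp.linearEquiv 2 ℂ (κ → ℂ)).symm.toLinearMap ∘ₗ Yᴴ.mulVecLin
  have hnorm : ∀ w, ‖f w‖ = ‖g w‖ := by
    intro w
    have h1 : star (Xᴴ *ᵥ w) ⬝ᵥ (Xᴴ *ᵥ w) = star (Yᴴ *ᵥ w) ⬝ᵥ (Yᴴ *ᵥ w) := by
      rw [← sesq_gram, ← sesq_gram, Matrix.conjTranspose_conjTranspose,
        Matrix.conjTranspose_conjTranspose, h]
    rw [star_dotProduct_self_eq_norm, star_dotProduct_self_eq_norm] at h1
    exact (sq_eq_sq₀ (norm_nonneg _) (norm_nonneg _)).mp (by exact_mod_cast h1)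
  -- `Xᴴ w ↦ Yᴴ w` is a well-defined isometry on the range of `Xᴴ`, because the Gram matrices agree.
  -- The section `s` realises it; it is then extended to the whole space and diagonalised.
  obtain ⟨s, hs⟩ := f.rangeRestrict.exists_rightInverse_of_surjective f.range_rangeRestrict
  have hs' : ∀ y, f (s y) = y := fun y => congrArg Subtype.val (LinearMap.congr_fun hs y)
  let L : LinearMap.range f →ₗᵢ[ℂ] EuclideanSpace ℂ κ :=
    { toLinearMap := g ∘ₗ s
      norm_map' := fun y => by
        change ‖g (s y)‖ = ‖(y : EuclideanSpace ℂ κ)‖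
        rw [← hnorm, hs'] }
  have hU : ∀ w, L.extend (f w) = g w := by
    intro w
    have h1 := L.extend_apply ⟨f w, LinearMap.mem_range_self f w⟩
    rw [h1]
    change g (s _) = g w
    rw [← sub_eq_zero, ← map_sub, ← norm_eq_zero, ← hnorm, norm_eq_zero, map_sub, sub_eq_zero, hs']
  obtain ⟨b, hb⟩ := exists_orthonormalBasis_eigenvectors L.extend
  choose z hz hbz using hb
  let e : Fin (finrank ℂ (EuclideanSpace ℂ κ)) ≃ κ :=
    Fintype.equivOfCardEq (by simp)
  refine ⟨Matrix.of fun j i => b (e.symm i) j, fun i => star (z (e.symm i)), ?_, ?_, ?_⟩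
  · rw [mul_eq_one_comm]
    ext i j
    have h1 := orthonormal_iff_ite.mp b.orthonormal (e.symm i) (e.symm j)
    rw [PiLp.inner_apply] at h1
    simpa [Matrix.mul_apply, Matrix.one_apply, mul_comm] using h1
  · intro i
    rw [norm_star, hz]
  · ext j i
    have h1 : inner ℂ (g (Pi.single j 1)) (b (e.symm i))
        = star (z (e.symm i)) * inner ℂ (f (Pi.single j 1)) (b (e.symm i)) := by
      rw [← hU]
      have h2 := L.extend.inner_map_map (f (Pi.single j 1)) (b (e.symm i))
      rw [hbz, inner_smul_right] at h2
      rw [← h2, ← mul_assoc, Complex.star_def, Complex.conj_mul', hz]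
      norm_num
    rw [PiLp.inner_apply, PiLp.inner_apply] at h1
    have hf : ∀ k, (f (Pi.single j 1)).ofLp k = star (X j k) := fun k => by
      change (Xᴴ *ᵥ Pi.single j 1) k = _
      rw [Matrix.mulVec_single_one]
      rfl
    have hg : ∀ k, (g (Pi.single j 1)).ofLp k = star (Y j k) := fun k => by
      change (Yᴴ *ᵥ Pi.single j 1) k = _
      rw [Matrix.mulVec_single_one]
      rfl
    simp only [hf, hg, RCLike.inner_apply, ← Complex.star_def, star_star] at h1
    rw [Matrix.mul_diagonal, Matrix.mul_apply, Matrix.mul_apply, mul_comm]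
    simpa only [Matrix.of_apply, mul_comm] using h1

end Unitary

/-! ### State-input vectors and the matrix of the dissipation form. -/

section SumVectors

variable {n m : ℕ}

theorem exists_sum_elim (h : Fin n ⊕ Fin m → ℂ) : ∃ x u, h = Sum.elim x u :=
  ⟨h ∘ Sum.inl, h ∘ Sum.inr, (Sum.elim_comp_inl_inr h).symm⟩

theorem sum_elim_eq_zero_iff {x : Fin n → ℂ} {u : Fin m → ℂ} :
    Sum.elim x u = 0 ↔ x = 0 ∧ u = 0 := by
  rw [← Sum.elim_zero_zero]
  constructor
  · intro h
    exact ⟨funext fun i => congrFun h (Sum.inl i), funext fun i => congrFun h (Sum.inr i)⟩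
  · rintro ⟨rfl, rfl⟩
    rfl

/-- The projection `(x, u) ↦ x`, as a matrix. -/
def stateProj (n m : ℕ) : Matrix (Fin n) (Fin n ⊕ Fin m) ℂ := Matrix.fromCols 1 0

@[simp]
theorem stateProj_mulVec (x : Fin n → ℂ) (u : Fin m → ℂ) :
    stateProj n m *ᵥ Sum.elim x u = x := by
  simp [stateProj]

theorem isRealMatrix_stateProj : IsRealMatrix (stateProj n m) :=
  IsRealMatrix.one.fromCols IsRealMatrix.zero

/-- The matrix of the form `σ(x, u) + x' P x - (A x + B u)' P (A x + B u)`. -/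
def kyp (A : Matrix (Fin n) (Fin n) ℂ) (B : Matrix (Fin n) (Fin m) ℂ)
    (Q : Matrix (Fin n ⊕ Fin m) (Fin n ⊕ Fin m) ℂ) (P : Matrix (Fin n) (Fin n) ℂ) :
    Matrix (Fin n ⊕ Fin m) (Fin n ⊕ Fin m) ℂ :=
  Q + (stateProj n m)ᴴ * P * stateProj n m -
    (Matrix.fromCols A B)ᴴ * P * Matrix.fromCols A B

variable {A : Matrix (Fin n) (Fin n) ℂ} {B : Matrix (Fin n) (Fin m) ℂ}
  {Q : Matrix (Fin n ⊕ Fin m) (Fin n ⊕ Fin m) ℂ} {P : Matrix (Fin n) (Fin n) ℂ}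

theorem sesq_kyp (x y : Fin n → ℂ) (u v : Fin m → ℂ) :
    sesq (kyp A B Q P) (Sum.elim x u) (Sum.elim y v) =
      sesq Q (Sum.elim x u) (Sum.elim y v) + sesq P x y
        - sesq P (A *ᵥ x + B *ᵥ u) (A *ᵥ y + B *ᵥ v) := by
  simp only [kyp, sesq_sub, sesq_add, sesq_congr, stateProj_mulVec,
    Matrix.fromCols_mulVec_sumElim]

theorem form_kyp (x : Fin n → ℂ) (u : Fin m → ℂ) :
    form (kyp A B Q P) (Sum.elim x u) =
      form Q (Sum.elim x u) + form P x - form P (A *ᵥ x + B *ᵥ u) :=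
  sesq_kyp x x u u

theorem isHermitian_kyp (hQ : Q.IsHermitian) (hP : P.IsHermitian) :
    (kyp A B Q P).IsHermitian :=
  (hQ.add (Matrix.isHermitian_conjTranspose_mul_mul _ hP)).sub
    (Matrix.isHermitian_conjTranspose_mul_mul _ hP)

theorem isRealMatrix_kyp (hA : IsRealMatrix A) (hB : IsRealMatrix B) (hQ : IsRealMatrix Q)
    (hP : IsRealMatrix P) : IsRealMatrix (kyp A B Q P) :=
  (hQ.add ((isRealMatrix_stateProj.conjTranspose.mul hP).mul isRealMatrix_stateProj)).sub
    (((hA.fromCols hB).conjTranspose.mul hP).mul (hA.fromCols hB))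

/-- This allows `Q` to be normalised by one choice of `P`, the normalised problem to be solved, and
the two choices to be added. -/
theorem kyp_kyp (P₁ P₂ : Matrix (Fin n) (Fin n) ℂ) :
    kyp A B (kyp A B Q P₁) P₂ = kyp A B Q (P₁ + P₂) := by
  simp only [kyp, Matrix.mul_add, Matrix.add_mul]
  abel

theorem continuous_kyp : Continuous fun P => kyp A B Q P := by
  unfold kyp
  fun_prop

theorem form_gram_fromCols (C : Matrix (Fin m) (Fin n) ℂ) (D : Matrix (Fin m) (Fin m) ℂ)
    (x : Fin n → ℂ) (u : Fin m → ℂ) :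
    form ((Matrix.fromCols C D)ᴴ * Matrix.fromCols C D) (Sum.elim x u) =
      ((∑ i, ‖(C *ᵥ x + D *ᵥ u) i‖ ^ 2 : ℝ) : ℂ) := by
  rw [form_eq_sesq, sesq_gram, Matrix.fromCols_mulVec_sumElim, star_dotProduct_self]

end SumVectors

/-! ### Positive semidefinite matrices: closedness and bounds by the trace. -/

section PosSemidef

variable {ι : Type*} [Fintype ι]

theorem isClosed_posSemidef : IsClosed {M : Matrix ι ι ℂ | M.PosSemidef} := by
  simp only [posSemidef_iff_re, Set.ofPred_and, Set.ofPred_forall]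
  refine IsClosed.inter (isClosed_eq (by fun_prop) continuous_id)
    (isClosed_iInter fun v => isClosed_le continuous_const ?_)
  exact Complex.continuous_re.comp (continuous_form v)

theorem form_single [DecidableEq ι] (M : Matrix ι ι ℂ) (i : ι) :
    form M (Pi.single i 1) = M i i := by
  rw [form_eq_sesq, sesq_single]

theorem diag_re_nonneg {M : Matrix ι ι ℂ} (hM : M.PosSemidef) (i : ι) : 0 ≤ (M i i).re := by
  classical
  rw [← form_single M]
  exact (posSemidef_iff_re.mp hM).2 _

theorem norm_apply_le_trace {M : Matrix ι ι ℂ} (hM : M.PosSemidef) (i j : ι) :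
    ‖M i j‖ ≤ M.trace.re := by
  classical
  have h := norm_sesq_le hM (Pi.single i 1) (Pi.single j 1)
  rw [sesq_single, form_single, form_single] at h
  have hle : ∀ k, (M k k).re ≤ M.trace.re := fun k => by
    rw [Matrix.trace, Complex.re_sum]
    exact Finset.single_le_sum (f := fun k => (M.diag k).re) (fun k _ => diag_re_nonneg hM k)
      (Finset.mem_univ k)
  linarith [hle i, hle j]

theorem form_re_le_trace {M : Matrix ι ι ℂ} (hM : M.PosSemidef) (v : ι → ℂ) :
    (form M v).re ≤ M.trace.re * (∑ i, ‖v i‖) ^ 2 := by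
  calc (form M v).re ≤ ‖form M v‖ := Complex.re_le_norm _
    _ ≤ ∑ i, ‖v i‖ * ∑ j, M.trace.re * ‖v j‖ := by
      refine (norm_sum_le _ _).trans (Finset.sum_le_sum fun i _ => ?_)
      rw [norm_mul, Pi.star_apply, norm_star]
      refine mul_le_mul_of_nonneg_left ((norm_sum_le _ _).trans ?_) (norm_nonneg _)
      refine Finset.sum_le_sum fun j _ => ?_
      rw [norm_mul]
      exact mul_le_mul_of_nonneg_right (norm_apply_le_trace hM i j) (norm_nonneg _)
    _ = M.trace.re * (∑ i, ‖v i‖) ^ 2 := by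
      rw [← Finset.mul_sum, ← Finset.sum_mul]
      ring

end PosSemidef

/-! ### The linear-quadratic regulator with positive definite cost. -/

section Regulator

open Filter Topology

variable {n m : ℕ} {A : Matrix (Fin n) (Fin n) ℂ} {B : Matrix (Fin n) (Fin m) ℂ}
  {F : Matrix (Fin n ⊕ Fin m) (Fin n ⊕ Fin m) ℂ}

/-- The lower bounds of the optimal cost of the regulator problem. -/
def subsolutions (A : Matrix (Fin n) (Fin n) ℂ) (B : Matrix (Fin n) (Fin m) ℂ)
    (F : Matrix (Fin n ⊕ Fin m) (Fin n ⊕ Fin m) ℂ) : Set (Matrix (Fin n) (Fin n) ℂ) :=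
  {V | V.PosSemidef ∧ (kyp A B F (-V)).PosSemidef}

/-- A subsolution is at most the cost of any feedback over `N` steps plus its own value at the final
state. For a stabilizing feedback and large `N` the final term is at most half the trace and can be
absorbed. -/
theorem exists_trace_bound (hAB : Stabilizable A B) :
    ∃ c : ℝ, ∀ V ∈ subsolutions A B F, V.trace.re ≤ c := by
  obtain ⟨K, hK⟩ := hAB
  have hS : Stable (A + B * K) := fun z hz => by
    rw [← sub_sub]
    exact hK z hz
  set S := A + B * K with hSdef
  have hlim : Tendsto (fun t : ℕ => ∑ j, (∑ i, ‖((S ^ t) *ᵥ Pi.single j 1) i‖) ^ 2) atTop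
      (𝓝 0) := by
    have h1 : ∀ j i, Tendsto (fun t : ℕ => ‖((S ^ t) *ᵥ Pi.single j 1) i‖) atTop (𝓝 0) :=
      fun j i => by
        have h2 := tendsto_pi_nhds.mp (hS.tendsto_pow_mulVec (Pi.single j 1)) i
        simpa using h2.norm
    have h3 := tendsto_finsetSum Finset.univ fun j _ =>
      (tendsto_finsetSum Finset.univ fun i _ => h1 j i).pow 2
    simpa using h3
  obtain ⟨N, hN⟩ := (hlim.eventually_le_const (show (0 : ℝ) < 1 / 2 by norm_num)).exists
  let s : (Fin n → ℂ) → ℝ := fun x =>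
    ∑ t ∈ Finset.range N, (form F (Sum.elim ((S ^ t) *ᵥ x) (K *ᵥ ((S ^ t) *ᵥ x)))).re
  refine ⟨2 * ∑ j, s (Pi.single j 1), fun V hV => ?_⟩
  have hstep : ∀ x, (form V x).re ≤ (form F (Sum.elim x (K *ᵥ x))).re + (form V (S *ᵥ x)).re := by
    intro x
    have h := (posSemidef_iff_re.mp hV.2).2 (Sum.elim x (K *ᵥ x))
    rw [form_kyp, Matrix.mulVec_mulVec, ← Matrix.add_mulVec, ← hSdef, form_eq_sesq (-V),
      form_eq_sesq (-V), sesq_neg, sesq_neg] at h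
    simp only [Complex.add_re, Complex.sub_re, Complex.neg_re, ← form_eq_sesq] at h
    linarith
  have hiter : ∀ t x, (form V x).re ≤ ∑ k ∈ Finset.range t,
      (form F (Sum.elim ((S ^ k) *ᵥ x) (K *ᵥ ((S ^ k) *ᵥ x)))).re + (form V ((S ^ t) *ᵥ x)).re := by
    intro t x
    induction t with
    | zero => simp
    | succ t ih =>
      have h := hstep ((S ^ t) *ᵥ x)
      rw [Matrix.mulVec_mulVec _ S, ← pow_succ'] at h
      rw [Finset.sum_range_succ]
      linarith
  have htr : V.trace.re = ∑ j, (form V (Pi.single j 1)).re := by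
    simp only [form_single, Matrix.trace, Complex.re_sum, Matrix.diag_apply]
  have hsum : V.trace.re ≤ ∑ j, (s (Pi.single j 1) +
      V.trace.re * (∑ i, ‖((S ^ N) *ᵥ Pi.single j 1) i‖) ^ 2) := by
    nth_rewrite 1 [htr]
    exact Finset.sum_le_sum fun j _ =>
      (hiter N _).trans (add_le_add le_rfl (form_re_le_trace hV.1 _))
  rw [Finset.sum_add_distrib, ← Finset.mul_sum] at hsum
  have h0 : 0 ≤ V.trace.re := by
    rw [htr]
    exact Finset.sum_nonneg fun j _ => (posSemidef_iff_re.mp hV.1).2 _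
  nlinarith [mul_le_mul_of_nonneg_left hN h0]

theorem posDef_add_congr (hF : F.PosDef) {V : Matrix (Fin n) (Fin n) ℂ} (hV : V.PosSemidef) :
    (F + (Matrix.fromCols A B)ᴴ * V * Matrix.fromCols A B).PosDef :=
  hF.add_posSemidef (hV.conjTranspose_mul_mul_same _)

/-- Completion of the square in the second block of a positive definite matrix. -/
theorem exists_schur {M : Matrix (Fin n ⊕ Fin m) (Fin n ⊕ Fin m) ℂ} (hM : M.PosDef) :
    ∃ (W : Matrix (Fin n) (Fin n) ℂ) (C : Matrix (Fin m) (Fin n) ℂ)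
      (D : Matrix (Fin m) (Fin m) ℂ), W.IsHermitian ∧ IsUnit D.det ∧
      M = (Matrix.fromCols C D)ᴴ * Matrix.fromCols C D + (stateProj n m)ᴴ * W * stateProj n m ∧
      (IsRealMatrix M → IsRealMatrix W ∧ IsRealMatrix C ∧ IsRealMatrix D) := by
  have h22 : (M.toBlocks₂₂).PosDef := hM.submatrix Sum.inr_injective
  obtain ⟨D, hD, hDr⟩ := exists_gram_factor h22
  have hdet : IsUnit D.det := by
    have h := (Matrix.isUnit_iff_isUnit_det _).mp h22.isUnit
    rw [← hD, Matrix.det_mul] at h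
    exact isUnit_of_mul_isUnit_right h
  have hdet' : IsUnit (Dᴴ).det := by
    rw [Matrix.det_conjTranspose]
    exact hdet.star
  have hH : M.toBlocks₁₂ = (M.toBlocks₂₁)ᴴ := by
    ext i j
    exact (hM.1.apply _ _).symm
  have hH1 : (M.toBlocks₁₁).IsHermitian := by
    ext i j
    exact hM.1.apply _ _
  set C := (Dᴴ)⁻¹ * M.toBlocks₂₁ with hC
  have hDC : Dᴴ * C = M.toBlocks₂₁ := by
    rw [hC, ← Matrix.mul_assoc, Matrix.mul_nonsing_inv _ hdet', Matrix.one_mul]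
  have hCD : Cᴴ * D = M.toBlocks₁₂ := by
    rw [hH, ← hDC, Matrix.conjTranspose_mul Dᴴ, Matrix.conjTranspose_conjTranspose]
  refine ⟨M.toBlocks₁₁ - Cᴴ * C, C, D,
    hH1.sub (Matrix.isHermitian_conjTranspose_mul_self C), hdet, ?_, fun hr => ?_⟩
  · rw [stateProj, Matrix.conjTranspose_fromCols_eq_fromRows_conjTranspose,
      Matrix.conjTranspose_fromCols_eq_fromRows_conjTranspose, Matrix.fromRows_mul_fromCols,
      Matrix.fromRows_mul, Matrix.fromRows_mul_fromCols, hD, hDC, hCD]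
    simp [Matrix.fromBlocks_add, Matrix.fromBlocks_toBlocks]
  · have hDr' := hDr (hr.submatrix Sum.inr Sum.inr)
    have hCr : IsRealMatrix C :=
      (hDr'.conjTranspose.inv hdet').mul (hr.submatrix Sum.inr Sum.inl)
    exact ⟨(hr.submatrix Sum.inl Sum.inl).sub (hCr.conjTranspose.mul hCr), hCr, hDr'⟩

open scoped Matrix.Norms.Elementwise in
-- The subsolutions form a compact set. The proposition `r` switches on a reality constraint, which
-- is closed as well, so that the maximizer can be sought among real matrices when the data are
-- real.
theorem exists_max_subsolution (hAB : Stabilizable A B) (hF : F.PosDef) (r : Prop) :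
    ∃ V ∈ subsolutions A B F, (r → IsRealMatrix V) ∧
      ∀ W ∈ subsolutions A B F, (r → IsRealMatrix W) → W.trace.re ≤ V.trace.re := by
  obtain ⟨c, hc⟩ := exists_trace_bound (F := F) hAB
  let T : Set (Matrix (Fin n) (Fin n) ℂ) := {V | V ∈ subsolutions A B F ∧ (r → IsRealMatrix V)}
  have hclosed : IsClosed T := by
    refine IsClosed.inter (IsClosed.inter isClosed_posSemidef
      (isClosed_posSemidef.preimage (continuous_kyp.comp continuous_neg))) ?_
    change IsClosed {V : Matrix (Fin n) (Fin n) ℂ | r → IsRealMatrix V}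
    by_cases hr : r
    · simpa only [hr, true_imp_iff] using isClosed_isRealMatrix
    · simp only [hr, false_imp_iff, Set.ofPred_true, isClosed_univ]
  have hbdd : Bornology.IsBounded T := by
    refine isBounded_iff_forall_norm_le.mpr ⟨max c 0, fun V hV => ?_⟩
    refine (Matrix.norm_le_iff (le_max_right _ _)).mpr fun i j => ?_
    exact (norm_apply_le_trace hV.1.1 i j).trans ((hc V hV.1).trans (le_max_left _ _))
  have hne : T.Nonempty := by
    refine ⟨0, ⟨Matrix.PosSemidef.zero, ?_⟩, fun _ => IsRealMatrix.zero⟩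
    simpa [kyp] using hF.posSemidef
  obtain ⟨V, hV, hmax⟩ := (Metric.isCompact_of_isClosed_isBounded hclosed hbdd).exists_isMaxOn hne
    (f := fun V => V.trace.re) (Continuous.continuousOn (by fun_prop))
  exact ⟨V, hV.1, hV.2, fun W hW hWr => hmax ⟨hW, hWr⟩⟩

/-- The optimal cost of a regulator problem with positive definite running cost. -/
theorem exists_regulator (hAB : Stabilizable A B) (hF : F.PosDef) :
    ∃ (V : Matrix (Fin n) (Fin n) ℂ) (C : Matrix (Fin m) (Fin n) ℂ)
      (D : Matrix (Fin m) (Fin m) ℂ), V.IsHermitian ∧ IsUnit D.det ∧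
      kyp A B F (-V) = (Matrix.fromCols C D)ᴴ * Matrix.fromCols C D ∧
      (∀ l : ℂ, ‖l‖ ≤ 1 → ∀ x u, x = l • (A *ᵥ x + B *ᵥ u) → C *ᵥ x + D *ᵥ u = 0 →
        x = 0 ∧ u = 0) ∧
      (IsRealMatrix A → IsRealMatrix B → IsRealMatrix F →
        IsRealMatrix V ∧ IsRealMatrix C ∧ IsRealMatrix D) := by
  obtain ⟨V, hV, hVr, hmax⟩ := exists_max_subsolution hAB hF
    (IsRealMatrix A ∧ IsRealMatrix B ∧ IsRealMatrix F)
  obtain ⟨W, C, D, hW, hD, hM, hr⟩ := exists_schur (posDef_add_congr (A := A) (B := B) hF hV.1)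
  have hF' := posSemidef_iff_re.mp hV.1
  have hform : ∀ x u, (form F (Sum.elim x u)).re + (form V (A *ᵥ x + B *ᵥ u)).re =
      ∑ i, ‖(C *ᵥ x + D *ᵥ u) i‖ ^ 2 + (form W x).re := by
    intro x u
    have h := congrArg (fun M => (form M (Sum.elim x u)).re) hM
    simp only [form_eq_sesq _ (Sum.elim x u), sesq_add, sesq_congr, stateProj_mulVec,
      Matrix.fromCols_mulVec_sumElim, Complex.add_re] at h
    rw [← form_eq_sesq ((Matrix.fromCols C D)ᴴ * _), form_gram_fromCols, Complex.ofReal_re] at h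
    exact h
  have hneg : ∀ (R : Matrix (Fin n) (Fin n) ℂ) x u, (form (kyp A B F (-R)) (Sum.elim x u)).re =
      (form F (Sum.elim x u)).re - (form R x).re + (form R (A *ᵥ x + B *ᵥ u)).re := by
    intro R x u
    rw [form_kyp, form_eq_sesq (-R), form_eq_sesq (-R), sesq_neg, sesq_neg]
    simp only [Complex.add_re, Complex.sub_re, Complex.neg_re, ← form_eq_sesq]
    ring
  have hsub : ∀ x, (form (W - V) x).re = (form W x).re - (form V x).re := fun x => by
    rw [form_eq_sesq, sesq_sub, Complex.sub_re, form_eq_sesq, form_eq_sesq]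
  -- `W` is the Schur complement, the result of one step of value iteration from `V`. The input that
  -- annihilates the square attains it, and the subsolution inequality for `V` at this input reads
  -- `V ≤ W`.
  have hWV : (W - V).PosSemidef := by
    refine posSemidef_iff_re.mpr ⟨hW.sub hF'.1, fun x => ?_⟩
    have hu : C *ᵥ x + D *ᵥ (-(D⁻¹ *ᵥ (C *ᵥ x))) = 0 := by
      rw [Matrix.mulVec_neg, Matrix.mulVec_mulVec, Matrix.mul_nonsing_inv _ hD, Matrix.one_mulVec,
        add_neg_cancel]
    have h1 := (posSemidef_iff_re.mp hV.2).2 (Sum.elim x (-(D⁻¹ *ᵥ (C *ᵥ x))))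
    have h2 := hform x (-(D⁻¹ *ᵥ (C *ᵥ x)))
    rw [hu] at h2
    rw [hneg] at h1
    simp only [Pi.zero_apply, norm_zero, ne_eq, OfNat.ofNat_ne_zero, not_false_eq_true,
      zero_pow, Finset.sum_const_zero, zero_add] at h2
    rw [hsub]
    linarith
  -- Replacing `V` by the larger `W` in the cost-to-go term only increases the form, so `W` is again
  -- a subsolution.
  have hWs : W ∈ subsolutions A B F := by
    refine ⟨by simpa using hWV.add hV.1, ?_⟩
    refine posSemidef_iff_re.mpr ⟨isHermitian_kyp hF.1 hW.neg, fun h => ?_⟩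
    obtain ⟨x, u, rfl⟩ := exists_sum_elim h
    have h1 := hform x u
    have h2 := (posSemidef_iff_re.mp hWV).2 (A *ᵥ x + B *ᵥ u)
    have h3 : 0 ≤ ∑ i, ‖(C *ᵥ x + D *ᵥ u) i‖ ^ 2 := by positivity
    rw [hsub] at h2
    rw [hneg]
    linarith
  have hreal : IsRealMatrix A ∧ IsRealMatrix B ∧ IsRealMatrix F →
      IsRealMatrix W ∧ IsRealMatrix C ∧ IsRealMatrix D := fun h =>
    hr (h.2.2.add (((h.1.fromCols h.2.1).conjTranspose.mul (hVr h)).mul (h.1.fromCols h.2.1)))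
  -- Maximality of the trace of `V` forces `W - V ≥ 0` to have trace zero. Thus `V` is a fixed
  -- point, which is the Riccati equation.
  have hEq : W = V := by
    have h1 := hmax W hWs fun h => (hreal h).1
    have h2 := hWV.trace_nonneg
    have h3 : (W - V).trace = 0 := by
      refine le_antisymm ?_ h2
      rw [Complex.le_def]
      refine ⟨?_, (Complex.le_def.mp h2).2.symm⟩
      simp only [Matrix.trace_sub, Complex.sub_re, Complex.zero_re]
      linarith
    exact sub_eq_zero.mp (hWV.trace_eq_zero_iff.mp h3)
  subst hEq
  refine ⟨W, C, D, hW, hD, ?_, ?_, fun h1 h2 h3 => hreal ⟨h1, h2, h3⟩⟩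
  · rw [← sub_eq_iff_eq_add] at hM
    rw [← hM, kyp, Matrix.mul_neg, Matrix.neg_mul, Matrix.mul_neg, Matrix.neg_mul]
    abel
  -- With zero output the running cost equals the form of `V` at `x` minus that at `A x + B u`. This
  -- is nonpositive because `x = l (A x + B u)` with `|l| ≤ 1`, so positive definiteness of `F`
  -- applies.
  · intro l hl x u hx hCD
    have h1 := hform x u
    rw [hCD] at h1
    simp only [Pi.zero_apply, norm_zero, ne_eq, OfNat.ofNat_ne_zero, not_false_eq_true,
      zero_pow, Finset.sum_const_zero, zero_add] at h1
    have h2 : (form W x).re ≤ (form W (A *ᵥ x + B *ᵥ u)).re := by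
      nth_rewrite 1 [hx]
      rw [form_smul_vec_re]
      exact mul_le_of_le_one_left (hF'.2 _) (pow_le_one₀ (norm_nonneg _) hl)
    by_contra hcon
    have := (posDef_iff_re.mp hF).2 (Sum.elim x u) (mt sum_elim_eq_zero_iff.mp hcon)
    linarith

end Regulator

/-! ### The strict KYP lemma by separation of convex sets. -/

section Strict

variable {n m : ℕ} {A : Matrix (Fin n) (Fin n) ℂ} {B : Matrix (Fin n) (Fin m) ℂ}
  {Q : Matrix (Fin n ⊕ Fin m) (Fin n ⊕ Fin m) ℂ}

/-- The form is positive along all nonzero harmonic motions `x_t = z ^ t x`, `u_t = z ^ t u` of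
the system with frequency `z` on the unit circle. -/
def HarmonicPos (A : Matrix (Fin n) (Fin n) ℂ) (B : Matrix (Fin n) (Fin m) ℂ)
    (Q : Matrix (Fin n ⊕ Fin m) (Fin n ⊕ Fin m) ℂ) (z : ℂ) : Prop :=
  ∀ x u, A *ᵥ x + B *ᵥ u = z • x → Sum.elim x u ≠ 0 → 0 < (form Q (Sum.elim x u)).re

theorem trace_conjTranspose_mul_mul_re {ι κ : Type*} [Fintype ι] [Fintype κ]
    (M : Matrix ι ι ℂ) (G : Matrix ι κ ℂ) :
    (Gᴴ * M * G).trace.re = ∑ j, (form M fun i => G i j).re := by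
  classical
  rw [Matrix.trace, Complex.re_sum]
  refine Finset.sum_congr rfl fun j _ => ?_
  rw [Matrix.diag_apply, ← sesq_single (Gᴴ * M * G), sesq_congr, Matrix.mulVec_single_one]
  rfl

open scoped MatrixOrder in
/-- A stationary covariance of nonpositive cost vanishes. -/
theorem covariance_eq_zero (hpos : ∀ z : ℂ, ‖z‖ = 1 → HarmonicPos A B Q z)
    {H : Matrix (Fin n ⊕ Fin m) (Fin n ⊕ Fin m) ℂ} (hH : H.PosSemidef)
    (hst : stateProj n m * H * (stateProj n m)ᴴ = Matrix.fromCols A B * H * (Matrix.fromCols A B)ᴴ)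
    (hle : (Q * H).trace.re ≤ 0) : H = 0 := by
  obtain ⟨S, hS⟩ := CStarAlgebra.nonneg_iff_eq_star_mul_self.mp hH.nonneg
  rw [Matrix.star_eq_conjTranspose] at hS
  have hXY : (stateProj n m * Sᴴ) * (stateProj n m * Sᴴ)ᴴ =
      (Matrix.fromCols A B * Sᴴ) * (Matrix.fromCols A B * Sᴴ)ᴴ := by
    simpa only [Matrix.conjTranspose_mul, Matrix.conjTranspose_conjTranspose, hS,
      Matrix.mul_assoc] using hst
  -- The columns of `G = Sᴴ V` are harmonic motions with frequencies `d j`, and `H = G Gᴴ` is the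
  -- sum of their rank one covariances.
  obtain ⟨V, d, hV, hd, hYV⟩ := exists_unitary_diagonal hXY
  obtain ⟨G, hG⟩ : ∃ G, G = Sᴴ * V := ⟨_, rfl⟩
  have hHG : H = G * Gᴴ := by
    rw [hG, Matrix.conjTranspose_mul, Matrix.conjTranspose_conjTranspose, Matrix.mul_assoc,
      ← Matrix.mul_assoc V, hV, Matrix.one_mul, hS]
  have hcol : ∀ j, Matrix.fromCols A B *ᵥ (fun i => G i j) =
      d j • (stateProj n m *ᵥ fun i => G i j) := by
    intro j
    have h1 : (Matrix.fromCols A B * G) *ᵥ Pi.single j 1 =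
        (stateProj n m * G * Matrix.diagonal d) *ᵥ Pi.single j 1 := by
      rw [hG, ← Matrix.mul_assoc, ← Matrix.mul_assoc, hYV]
    have h2 : G *ᵥ Pi.single j 1 = fun i => G i j := Matrix.mulVec_single_one G j
    have h3 : Matrix.diagonal d *ᵥ Pi.single j 1 = d j • Pi.single j 1 := by
      ext i
      rcases eq_or_ne i j with rfl | hij
      · simp
      · simp [hij]
    rwa [← Matrix.mulVec_mulVec, ← Matrix.mulVec_mulVec, h3, Matrix.mulVec_smul,
      ← Matrix.mulVec_mulVec, h2] at h1
  have hcase : ∀ j, (fun i => G i j) ≠ 0 → 0 < (form Q fun i => G i j).re := by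
    intro j
    have h1 := hcol j
    obtain ⟨x, u, hxu⟩ := exists_sum_elim fun i => G i j
    rw [hxu] at h1 ⊢
    rw [stateProj_mulVec, Matrix.fromCols_mulVec_sumElim] at h1
    exact hpos (d j) (hd j) x u h1
  have hsum : ∑ j, (form Q fun i => G i j).re ≤ 0 := by
    rw [← trace_conjTranspose_mul_mul_re, Matrix.mul_assoc, Matrix.trace_mul_comm,
      Matrix.mul_assoc, ← hHG]
    exact hle
  have hnn : ∀ j, 0 ≤ (form Q fun i => G i j).re := by
    intro j
    by_cases h0 : (fun i => G i j) = 0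
    · rw [h0]
      simp [form]
    · exact (hcase j h0).le
  have hz := (Finset.sum_eq_zero_iff_of_nonneg fun j _ => hnn j).mp
    (le_antisymm hsum (Finset.sum_nonneg fun j _ => hnn j))
  have hG0 : G = 0 := by
    ext i j
    by_contra hne
    have := hcase j fun h => hne (congrFun h i)
    rw [hz j (Finset.mem_univ j)] at this
    exact lt_irrefl _ this
  rw [hHG, hG0, Matrix.zero_mul]

/-- A real functional on square matrices acts on rank one matrices `v v'` as a Hermitian form. -/
theorem exists_form_eq_functional {ι : Type*} [Fintype ι] (f : Matrix ι ι ℂ →ₗ[ℝ] ℝ) :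
    ∃ P : Matrix ι ι ℂ, P.IsHermitian ∧
      ∀ v, f (Matrix.vecMulVec v (star v)) = (form P v).re := by
  classical
  let N : Matrix ι ι ℂ := Matrix.of fun j i =>
    (f (Matrix.single i j 1) : ℂ) - Complex.I * f (Matrix.single i j Complex.I)
  refine ⟨(1 / 2 : ℂ) • (N + Nᴴ), ?_, fun v => ?_⟩
  · rw [Matrix.IsHermitian, Matrix.conjTranspose_smul, Matrix.conjTranspose_add,
      Matrix.conjTranspose_conjTranspose, add_comm Nᴴ]
    congr 1
    simp
  · have hN : (form N v).re = f (Matrix.vecMulVec v (star v)) := by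
      have hs : ∀ (i j : ι) (c : ℂ), f (Matrix.single i j c) = (c * N j i).re := by
        intro i j c
        have hc : Matrix.single i j c =
            c.re • Matrix.single i j (1 : ℂ) + c.im • Matrix.single i j Complex.I := by
          rw [Matrix.smul_single, Matrix.smul_single, ← Matrix.single_add]
          congr 1
          simp [Complex.re_add_im]
        rw [hc, map_add, map_smul, map_smul]
        simp [N, Complex.mul_re]
      rw [Matrix.matrix_eq_sum_single (Matrix.vecMulVec v (star v)), map_sum, form,
        dotProduct, Complex.re_sum]
      simp only [map_sum, hs, Matrix.mulVec, dotProduct, Finset.mul_sum, Complex.re_sum]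
      rw [Finset.sum_comm]
      refine Finset.sum_congr rfl fun i _ => Finset.sum_congr rfl fun j _ => ?_
      congr 1
      simp only [Matrix.vecMulVec_apply, Pi.star_apply]
      ring
    have hNH : (form Nᴴ v).re = (form N v).re := by
      rw [form_eq_sesq, ← star_sesq, Complex.star_def, Complex.conj_re, form_eq_sesq]
    rw [form_eq_sesq, sesq_smul, sesq_add, ← form_eq_sesq, ← form_eq_sesq, ← hN]
    have h2 : (1 / 2 : ℂ) = ((1 / 2 : ℝ) : ℂ) := by push_cast; ring
    rw [h2, Complex.re_ofReal_mul, Complex.add_re, hNH]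
    ring

theorem norm_form_le {ι : Type*} [Fintype ι] (M : Matrix ι ι ℂ) {v : ι → ℂ}
    (hv : ∀ i, ‖v i‖ ≤ 1) : ‖form M v‖ ≤ ∑ i, ∑ j, ‖M i j‖ := by
  refine (norm_sum_le _ _).trans (Finset.sum_le_sum fun i _ => ?_)
  rw [norm_mul, Pi.star_apply, norm_star]
  refine (mul_le_of_le_one_left (norm_nonneg _) (hv i)).trans ((norm_sum_le _ _).trans ?_)
  refine Finset.sum_le_sum fun j _ => ?_
  rw [norm_mul]
  exact mul_le_of_le_one_right (norm_nonneg _) (hv j)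

open scoped Matrix.Norms.Elementwise in
/-- Separation of the stationary covariances from those of nonpositive cost. -/
theorem exists_multiplier (hpos : ∀ z : ℂ, ‖z‖ = 1 → HarmonicPos A B Q z) :
    ∃ (P : Matrix (Fin n) (Fin n) ℂ) (q δ : ℝ), P.IsHermitian ∧ 0 ≤ q ∧ 0 < δ ∧
      ∀ x u, ∑ i, ‖Sum.elim x u i‖ ^ 2 = 1 →
        δ < (form P x).re - (form P (A *ᵥ x + B *ᵥ u)).re + q * (form Q (Sum.elim x u)).re := by
  let Φ : Matrix (Fin n ⊕ Fin m) (Fin n ⊕ Fin m) ℂ →ₗ[ℝ] Matrix (Fin n) (Fin n) ℂ × ℝ :=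
    { toFun := fun H => (stateProj n m * H * (stateProj n m)ᴴ -
        Matrix.fromCols A B * H * (Matrix.fromCols A B)ᴴ, (Q * H).trace.re)
      map_add' := fun H₁ H₂ => by
        ext1
        · simp only [Matrix.mul_add, Matrix.add_mul, Prod.mk_add_mk]
          abel
        · simp [Matrix.mul_add]
      map_smul' := fun c H => by
        ext1
        · simp [smul_sub]
        · simp }
  have hΦ : Continuous Φ := by
    change Continuous fun H => (stateProj n m * H * (stateProj n m)ᴴ -
        Matrix.fromCols A B * H * (Matrix.fromCols A B)ᴴ, (Q * H).trace.re)
    fun_prop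
  let T : Set (Matrix (Fin n ⊕ Fin m) (Fin n ⊕ Fin m) ℂ) := {H | H.PosSemidef ∧ H.trace = 1}
  have hTc : IsCompact T := by
    refine Metric.isCompact_of_isClosed_isBounded
      (isClosed_posSemidef.inter (isClosed_eq (by fun_prop) continuous_const)) ?_
    refine isBounded_iff_forall_norm_le.mpr ⟨1, fun H hH => ?_⟩
    refine (Matrix.norm_le_iff zero_le_one).mpr fun i j => ?_
    have h := norm_apply_le_trace hH.1 i j
    rwa [hH.2, Complex.one_re] at h
  have hTconv : Convex ℝ T := by
    intro H₁ h₁ H₂ h₂ a b ha hb hab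
    refine ⟨(h₁.1.smul ha).add (h₂.1.smul hb), ?_⟩
    rw [Matrix.trace_add, Matrix.trace_smul, Matrix.trace_smul, h₁.2, h₂.2, ← add_smul, hab,
      one_smul]
  have hNcl : IsClosed (({0} : Set (Matrix (Fin n) (Fin n) ℂ)) ×ˢ Set.Iic (0 : ℝ)) :=
    isClosed_singleton.prod isClosed_Iic
  have hNconv : Convex ℝ (({0} : Set (Matrix (Fin n) (Fin n) ℂ)) ×ˢ Set.Iic (0 : ℝ)) :=
    (convex_singleton 0).prod (convex_Iic 0)
  -- `Φ` records the stationarity defect and the cost of a covariance. Normalising the trace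
  -- excludes `H = 0`, so no point of `T` is stationary with nonpositive cost.
  have hdisj : Disjoint (Φ '' T) (({0} : Set (Matrix (Fin n) (Fin n) ℂ)) ×ˢ Set.Iic (0 : ℝ)) := by
    rw [Set.disjoint_left]
    rintro _ ⟨H, hH, rfl⟩ ⟨h1, h2⟩
    have h0 := covariance_eq_zero hpos hH.1 (sub_eq_zero.mp h1) h2
    have := hH.2
    rw [h0, Matrix.trace_zero] at this
    exact zero_ne_one this
  have : LocallyConvexSpace ℝ (Matrix (Fin n) (Fin n) ℂ) :=
    inferInstanceAs (LocallyConvexSpace ℝ (Fin n → Fin n → ℂ))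
  obtain ⟨f, s, t, hs, hst, ht⟩ := geometric_hahn_banach_compact_closed
    (hTconv.linear_image Φ) (hTc.image hΦ) hNconv hNcl hdisj
  have hsplit : ∀ M r, f (M, r) = f (M, 0) + r * f (0, 1) := by
    intro M r
    have : ((M, r) : Matrix (Fin n) (Fin n) ℂ × ℝ) = (M, 0) + r • (0, 1) := by simp
    rw [this, map_add, map_smul, smul_eq_mul]
  have ht0 : t < 0 := by
    have := ht 0 ⟨rfl, Set.mem_Iic.mpr le_rfl⟩
    rwa [map_zero] at this
  -- The functional exceeds `t` on the whole ray `(0, r)`, `r ≤ 0`; a positive slope would make it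
  -- equal to `t` at `r = t / f (0, 1)`.
  have hq : f (0, 1) ≤ 0 := by
    by_contra hcon
    have h1 := ht (0, t / f (0, 1)) ⟨rfl, (div_neg_of_neg_of_pos ht0 (not_le.mp hcon)).le⟩
    have h00 : f ((0 : Matrix (Fin n) (Fin n) ℂ), (0 : ℝ)) = 0 := map_zero f
    rw [hsplit, div_mul_cancel₀ _ (not_le.mp hcon).ne', h00] at h1
    linarith
  obtain ⟨P, hP, hPf⟩ := exists_form_eq_functional
    (f.toLinearMap ∘ₗ LinearMap.inl ℝ (Matrix (Fin n) (Fin n) ℂ) ℝ)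
  refine ⟨-P, -f (0, 1), -s, hP.neg, by linarith, by linarith, fun x u hxu => ?_⟩
  have hmem : Matrix.vecMulVec (Sum.elim x u) (star (Sum.elim x u)) ∈ T := by
    refine ⟨Matrix.posSemidef_vecMulVec_self_star _, ?_⟩
    rw [Matrix.trace_vecMulVec, dotProduct_comm, star_dotProduct_self, hxu, Complex.ofReal_one]
  have h1 := hs _ ⟨_, hmem, rfl⟩
  have hcong : ∀ M : Matrix (Fin n) (Fin n ⊕ Fin m) ℂ,
      M * Matrix.vecMulVec (Sum.elim x u) (star (Sum.elim x u)) * Mᴴ =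
        Matrix.vecMulVec (M *ᵥ Sum.elim x u) (star (M *ᵥ Sum.elim x u)) := fun M => by
    rw [Matrix.mul_vecMulVec, Matrix.vecMulVec_mul, Matrix.star_mulVec]
  have h2 : Φ (Matrix.vecMulVec (Sum.elim x u) (star (Sum.elim x u))) =
      (Matrix.vecMulVec x (star x) - Matrix.vecMulVec (A *ᵥ x + B *ᵥ u)
        (star (A *ᵥ x + B *ᵥ u)), (form Q (Sum.elim x u)).re) := by
    change (_, _) = _
    rw [hcong, hcong, stateProj_mulVec, Matrix.fromCols_mulVec_sumElim, Matrix.mul_vecMulVec,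
      Matrix.trace_vecMulVec, dotProduct_comm, form]
  have h3 : ∀ v, f (Matrix.vecMulVec v (star v), 0) = (form P v).re := hPf
  have h4 : ∀ M N : Matrix (Fin n) (Fin n) ℂ, f (M - N, 0) = f (M, 0) - f (N, 0) := by
    intro M N
    rw [← map_sub, Prod.mk_sub_mk, sub_zero]
  rw [h2, hsplit, h4, h3, h3] at h1
  rw [form_eq_sesq (-P), form_eq_sesq (-P), sesq_neg, sesq_neg, ← form_eq_sesq, ← form_eq_sesq,
    Complex.neg_re, Complex.neg_re]
  linarith

theorem sum_norm_sq_pos {ι : Type*} [Fintype ι] {v : ι → ℂ} (hv : v ≠ 0) :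
    0 < ∑ i, ‖v i‖ ^ 2 := by
  obtain ⟨i, hi⟩ := Function.ne_iff.mp hv
  exact Finset.sum_pos' (fun _ _ => by positivity)
    ⟨i, Finset.mem_univ i, pow_pos (norm_pos_iff.mpr hi) 2⟩

/-- To check that a Hermitian matrix is positive definite it suffices to consider unit vectors. -/
theorem posDef_of_unit {ι : Type*} [Fintype ι] {M : Matrix ι ι ℂ} (hM : M.IsHermitian)
    (h : ∀ v, ∑ i, ‖v i‖ ^ 2 = 1 → 0 < (form M v).re) : M.PosDef := by
  refine posDef_iff_re.mpr ⟨hM, fun v hv => ?_⟩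
  have hpos := sum_norm_sq_pos hv
  set c : ℝ := (√(∑ i, ‖v i‖ ^ 2))⁻¹ with hc
  have hc2 : c ^ 2 * ∑ i, ‖v i‖ ^ 2 = 1 := by
    rw [hc, inv_pow, Real.sq_sqrt hpos.le, inv_mul_cancel₀ hpos.ne']
  have hcn : ‖(c : ℂ)‖ ^ 2 = c ^ 2 := by
    rw [Complex.norm_real, Real.norm_eq_abs, sq_abs]
  have h1 := h ((c : ℂ) • v) (by
    simp only [Pi.smul_apply, norm_smul, mul_pow, ← Finset.mul_sum, hcn, hc2])
  rw [form_smul_vec_re, hcn] at h1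
  exact pos_of_mul_pos_right h1 (sq_nonneg c)

/-- For real data the transpose of a solution is again a solution; averaging the two produces a real
one. -/
theorem kyp_transpose (hA : IsRealMatrix A) (hB : IsRealMatrix B) (hQ : Q.IsHermitian)
    (hQr : IsRealMatrix Q) (P : Matrix (Fin n) (Fin n) ℂ) :
    kyp A B Q Pᵀ = (kyp A B Q P)ᵀ := by
  have htr : ∀ {ι κ : Type} {M : Matrix ι κ ℂ}, IsRealMatrix M → Mᴴ = Mᵀ := fun {ι κ M} hM => by
    ext i j
    exact Complex.conj_eq_iff_im.mpr (hM j i)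
  have hQT : Qᵀ = Q := by rw [← htr hQr, hQ.eq]
  rw [kyp, kyp, htr (isRealMatrix_stateProj), htr (hA.fromCols hB)]
  simp only [Matrix.transpose_sub, Matrix.transpose_add, Matrix.transpose_mul,
    Matrix.transpose_transpose, Matrix.mul_assoc, hQT]

/-- The strict Kalman–Yakubovich–Popov lemma. -/
theorem exists_kyp_posDef (hQ : Q.IsHermitian)
    (hpos : ∀ z : ℂ, ‖z‖ = 1 → HarmonicPos A B Q z) :
    ∃ P : Matrix (Fin n) (Fin n) ℂ, P.IsHermitian ∧ (kyp A B Q P).PosDef ∧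
      (IsRealMatrix A → IsRealMatrix B → IsRealMatrix Q → IsRealMatrix P) := by
  have main : ∃ P : Matrix (Fin n) (Fin n) ℂ, P.IsHermitian ∧ (kyp A B Q P).PosDef := by
    obtain ⟨P, q, δ, hP, hq, hδ, h⟩ := exists_multiplier hpos
    set c := ∑ i, ∑ j, ‖Q i j‖ with hc
    have hc0 : 0 ≤ c := by positivity
    -- The multiplier `q` may vanish. Adding `δ / (c + 1)` makes it positive, so that one can divide
    -- by it, and lowers the form on unit vectors by at most `δ`, since `|σ| ≤ c` there.
    have hη : 0 < δ / (c + 1) := by positivity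
    have hqη : 0 < q + δ / (c + 1) := by positivity
    have hPs : ((((q + δ / (c + 1))⁻¹ : ℝ) : ℂ) • P).IsHermitian := by
      rw [Matrix.IsHermitian, Matrix.conjTranspose_smul, hP.eq]
      congr 1
      exact Complex.conj_ofReal _
    refine ⟨(((q + δ / (c + 1))⁻¹ : ℝ) : ℂ) • P, hPs, ?_⟩
    refine posDef_of_unit (isHermitian_kyp hQ hPs) fun v hv => ?_
    obtain ⟨x, u, rfl⟩ := exists_sum_elim v
    have h1 := h x u hv
    have hv1 : ∀ i, ‖Sum.elim x u i‖ ≤ 1 := fun i => by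
      have h2 : ‖Sum.elim x u i‖ ^ 2 ≤ 1 := by
        rw [← hv]
        exact Finset.single_le_sum (f := fun i => ‖Sum.elim x u i‖ ^ 2)
          (fun _ _ => by positivity) (Finset.mem_univ i)
      exact (sq_le_one_iff₀ (norm_nonneg _)).mp h2
    have h3 : -c ≤ (form Q (Sum.elim x u)).re :=
      (abs_le.mp ((Complex.abs_re_le_norm _).trans (norm_form_le Q hv1))).1
    have h4 : -δ ≤ δ / (c + 1) * (form Q (Sum.elim x u)).re := by
      have h5 := mul_le_mul_of_nonneg_left h3 hη.le
      have h6 : δ / (c + 1) * c ≤ δ := by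
        rw [div_mul_eq_mul_div, div_le_iff₀ (by positivity)]
        nlinarith
      linarith
    rw [form_kyp, form_eq_sesq (_ • P), form_eq_sesq (_ • P), sesq_smul, sesq_smul,
      Complex.sub_re, Complex.add_re, Complex.re_ofReal_mul, Complex.re_ofReal_mul,
      ← form_eq_sesq, ← form_eq_sesq]
    refine pos_of_mul_pos_right (a := q + δ / (c + 1)) ?_ hqη.le
    rw [mul_sub, mul_add, ← mul_assoc, ← mul_assoc, mul_inv_cancel₀ hqη.ne']
    linarith
  obtain ⟨P, hP, hK⟩ := main
  by_cases hr : IsRealMatrix A ∧ IsRealMatrix B ∧ IsRealMatrix Q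
  · have hHalf : (1 / 2 : ℂ) = ((1 / 2 : ℝ) : ℂ) := by push_cast; ring
    -- For Hermitian `P` the transpose is the entrywise conjugate, so the average of both is the
    -- real part of `P`.
    have hPT : (P + Pᵀ).IsHermitian := hP.add hP.transpose
    refine ⟨((1 / 2 : ℝ) : ℂ) • (P + Pᵀ), ?_, ?_, fun _ _ _ => IsRealMatrix.smul ?_ _⟩
    · rw [Matrix.IsHermitian, Matrix.conjTranspose_smul, hPT.eq]
      congr 1
      exact Complex.conj_ofReal _
    · have h1 := hK.add hK.transpose
      rw [← kyp_transpose hr.1 hr.2.1 hQ hr.2.2] at h1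
      have h2 := h1.smul (show (0 : ℝ) < 1 / 2 by norm_num)
      convert h2 using 1
      rw [← Complex.coe_smul, ← hHalf]
      simp only [kyp, Matrix.mul_smul, Matrix.smul_mul, Matrix.mul_add, Matrix.add_mul]
      module
    · intro i j
      have := congrArg Complex.im (hP.apply i j)
      simp only [Complex.star_def, Complex.conj_im] at this
      simp only [Matrix.add_apply, Matrix.transpose_apply, Complex.add_im]
      linarith
  · exact ⟨P, hP, hK, fun h1 h2 h3 => absurd ⟨h1, h2, h3⟩ hr⟩

end Strict

/-! ### Polynomials without zeros in the open unit disc. -/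

section PolynomialBound

open Polynomial

/-- Factor by factor: `|w - a| ≤ 1 + |a|`, while `|l - a| ≥ |a| - |l| ≥ (1 + |a|) (1 - |l|) / 2`
because `|a| ≥ 1`. -/
theorem norm_prod_sub_le {l w : ℂ} (hw : ‖w‖ ≤ 1) (hl : ‖l‖ < 1) (s : Multiset ℂ)
    (hs : ∀ a ∈ s, 1 ≤ ‖a‖) :
    ‖(s.map fun a => w - a).prod‖ * ((1 - ‖l‖) / 2) ^ s.card ≤ ‖(s.map fun a => l - a).prod‖ := by
  induction s using Multiset.induction_on with
  | empty => simp
  | cons a s ih =>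
    have ha := hs a (Multiset.mem_cons_self a s)
    have ih' := ih fun b hb => hs b (Multiset.mem_cons_of_mem hb)
    rw [Multiset.map_cons, Multiset.prod_cons, Multiset.map_cons, Multiset.prod_cons,
      Multiset.card_cons, norm_mul, norm_mul, pow_succ]
    have h1 : ‖w - a‖ ≤ 1 + ‖a‖ := (norm_sub_le _ _).trans (by linarith)
    have h2 : ‖a‖ - ‖l‖ ≤ ‖l - a‖ := by
      rw [norm_sub_rev]
      exact norm_sub_norm_le a l
    have h3 : ‖w - a‖ * ((1 - ‖l‖) / 2) ≤ ‖l - a‖ := by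
      have h4 : ‖w - a‖ * ((1 - ‖l‖) / 2) ≤ (1 + ‖a‖) * ((1 - ‖l‖) / 2) :=
        mul_le_mul_of_nonneg_right h1 (by linarith)
      nlinarith [mul_nonneg (sub_nonneg.mpr ha) (norm_nonneg l)]
    calc ‖w - a‖ * ‖(s.map fun a => w - a).prod‖ * (((1 - ‖l‖) / 2) ^ s.card * ((1 - ‖l‖) / 2))
        = (‖w - a‖ * ((1 - ‖l‖) / 2)) *
          (‖(s.map fun a => w - a).prod‖ * ((1 - ‖l‖) / 2) ^ s.card) := by ring
      _ ≤ ‖l - a‖ * ‖(s.map fun a => l - a).prod‖ :=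
        mul_le_mul h3 ih' (mul_nonneg (norm_nonneg _) (pow_nonneg (by linarith) _)) (norm_nonneg _)

/-- A quantitative form of Hurwitz's theorem for polynomials without zeros in the unit disc. -/
theorem norm_eval_lower_bound {p : ℂ[X]} {N : ℕ} (hN : p.natDegree ≤ N)
    (hp : ∀ r : ℂ, ‖r‖ < 1 → p.eval r ≠ 0) {l w : ℂ} (hw : ‖w‖ ≤ 1) (hl : ‖l‖ < 1) :
    ‖p.eval w‖ * ((1 - ‖l‖) / 2) ^ N ≤ ‖p.eval l‖ := by
  have hsp := IsAlgClosed.splits p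
  have heval : ∀ x, p.eval x = p.leadingCoeff * (p.roots.map fun a => x - a).prod := fun x =>
    hsp.eval_eq_prod_roots x
  have hroots : ∀ a ∈ p.roots, 1 ≤ ‖a‖ := fun a ha => by
    by_contra hcon
    exact hp a (not_le.mp hcon) (isRoot_of_mem_roots ha)
  have hcard : p.roots.card ≤ N := (card_roots' p).trans hN
  have h := norm_prod_sub_le hw hl p.roots hroots
  have h0 : (0 : ℝ) ≤ (1 - ‖l‖) / 2 := by linarith
  have h1 : (1 - ‖l‖) / 2 ≤ 1 := by linarith [norm_nonneg l]
  rw [heval, heval, norm_mul, norm_mul, mul_assoc]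
  refine mul_le_mul_of_nonneg_left (le_trans ?_ h) (norm_nonneg _)
  -- The base is at most one, so the number of roots may be replaced by the degree bound `N`, which
  -- makes the estimate uniform over a family of polynomials.
  exact mul_le_mul_of_nonneg_left (pow_le_pow_of_le_one h0 h1 hcard) (norm_nonneg _)

end PolynomialBound

/-! ### The system pencil and its zeros. -/

section Pencil

variable {n m : ℕ}

/-- The system matrix whose determinant vanishes at the zeros of the system. -/
def pencil (A : Matrix (Fin n) (Fin n) ℂ) (B : Matrix (Fin n) (Fin m) ℂ)
    (C : Matrix (Fin m) (Fin n) ℂ) (D : Matrix (Fin m) (Fin m) ℂ) (l : ℂ) :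
    Matrix (Fin n ⊕ Fin m) (Fin n ⊕ Fin m) ℂ :=
  Matrix.fromBlocks (l • A - 1) (l • B) C D

variable {A : Matrix (Fin n) (Fin n) ℂ} {B : Matrix (Fin n) (Fin m) ℂ}
  {C : Matrix (Fin m) (Fin n) ℂ} {D : Matrix (Fin m) (Fin m) ℂ}

theorem pencil_mulVec (l : ℂ) (x : Fin n → ℂ) (u : Fin m → ℂ) :
    pencil A B C D l *ᵥ Sum.elim x u =
      Sum.elim (l • (A *ᵥ x + B *ᵥ u) - x) (C *ᵥ x + D *ᵥ u) := by
  rw [pencil, Matrix.fromBlocks_mulVec, Sum.elim_comp_inl, Sum.elim_comp_inr]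
  congr 1
  rw [Matrix.sub_mulVec, Matrix.smul_mulVec, Matrix.smul_mulVec, Matrix.one_mulVec, smul_add]
  abel

theorem pencil_det_ne_zero_iff {l : ℂ} :
    (pencil A B C D l).det ≠ 0 ↔
      ∀ x u, x = l • (A *ᵥ x + B *ᵥ u) → C *ᵥ x + D *ᵥ u = 0 → x = 0 ∧ u = 0 := by
  constructor
  · intro h x u hx hu
    rw [← sum_elim_eq_zero_iff]
    refine Matrix.eq_zero_of_mulVec_eq_zero h ?_
    rw [pencil_mulVec, sum_elim_eq_zero_iff]
    exact ⟨sub_eq_zero.mpr hx.symm, hu⟩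
  · intro h hdet
    obtain ⟨v, hv, hv0⟩ := Matrix.exists_mulVec_eq_zero_iff.mpr hdet
    obtain ⟨x, u, rfl⟩ := exists_sum_elim v
    rw [pencil_mulVec, sum_elim_eq_zero_iff] at hv0
    exact hv (sum_elim_eq_zero_iff.mpr (h x u (sub_eq_zero.mp hv0.1).symm hv0.2))

open Polynomial in
theorem exists_pencil_polynomial (A : Matrix (Fin n) (Fin n) ℂ) (B : Matrix (Fin n) (Fin m) ℂ)
    (C : Matrix (Fin m) (Fin n) ℂ) (D : Matrix (Fin m) (Fin m) ℂ) :
    ∃ p : ℂ[X], p.natDegree ≤ n + m ∧ ∀ l, p.eval l = (pencil A B C D l).det := by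
  refine ⟨((X : ℂ[X]) • (Matrix.fromBlocks A B 0 0).map Polynomial.C +
    (Matrix.fromBlocks (-1) 0 C D).map Polynomial.C).det, ?_, fun l => ?_⟩
  · simpa using Polynomial.natDegree_det_X_add_C_le (Matrix.fromBlocks A B 0 0)
      (Matrix.fromBlocks (-1) 0 C D)
  · rw [← coe_evalRingHom, RingHom.map_det]
    congr 1
    ext i j
    rcases i with i | i <;> rcases j with j | j <;>
      simp [pencil, sub_eq_add_neg] <;> ring

theorem continuous_pencil (A : Matrix (Fin n) (Fin n) ℂ) (B : Matrix (Fin n) (Fin m) ℂ) (l : ℂ) :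
    Continuous fun p : Matrix (Fin m) (Fin n) ℂ × Matrix (Fin m) (Fin m) ℂ =>
      pencil A B p.1 p.2 l := by
  unfold pencil
  exact Continuous.matrix_fromBlocks continuous_const continuous_const continuous_fst continuous_snd

/-- If the system matrices of a family do not degenerate inside the disc, and the limit points of
the family do not degenerate at one point of the closed disc, then those limit points do not
degenerate inside the disc. -/
theorem pencil_det_ne_zero_of_mem_closure
    {S : Set (Matrix (Fin m) (Fin n) ℂ × Matrix (Fin m) (Fin m) ℂ)}
    (hdisc : ∀ p ∈ S, ∀ l : ℂ, ‖l‖ < 1 → (pencil A B p.1 p.2 l).det ≠ 0)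
    {w : ℂ} (hw : ‖w‖ ≤ 1) (hcl : ∀ p ∈ closure S, (pencil A B p.1 p.2 w).det ≠ 0)
    {l : ℂ} (hl : ‖l‖ < 1) : ∀ p ∈ closure S, (pencil A B p.1 p.2 l).det ≠ 0 := by
  intro p hp
  have hc : ∀ z, Continuous fun p : Matrix (Fin m) (Fin n) ℂ × Matrix (Fin m) (Fin m) ℂ =>
      ‖(pencil A B p.1 p.2 z).det‖ := fun z => (continuous_pencil A B z).matrix_det.norm
  have hclosed : IsClosed {p : Matrix (Fin m) (Fin n) ℂ × Matrix (Fin m) (Fin m) ℂ |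
      ‖(pencil A B p.1 p.2 w).det‖ * ((1 - ‖l‖) / 2) ^ (n + m) ≤ ‖(pencil A B p.1 p.2 l).det‖} :=
    isClosed_le ((hc w).mul continuous_const) (hc l)
  have hsub : S ⊆ {p : Matrix (Fin m) (Fin n) ℂ × Matrix (Fin m) (Fin m) ℂ |
      ‖(pencil A B p.1 p.2 w).det‖ * ((1 - ‖l‖) / 2) ^ (n + m) ≤
        ‖(pencil A B p.1 p.2 l).det‖} := by
    intro p hp
    obtain ⟨q, hq, hqe⟩ := exists_pencil_polynomial A B p.1 p.2
    have := norm_eval_lower_bound hq (fun r hr => by rw [hqe]; exact hdisc p hp r hr) hw hl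
    rwa [hqe, hqe] at this
  have h1 := closure_minimal hsub hclosed hp
  have h2 : 0 < ‖(pencil A B p.1 p.2 w).det‖ * ((1 - ‖l‖) / 2) ^ (n + m) :=
    mul_pos (norm_pos_iff.mpr (hcl p hp)) (pow_pos (by linarith) _)
  exact norm_pos_iff.mp (h2.trans_le h1)

end Pencil

/-! ### Regularized problems and the subspace where their solutions stay bounded. -/

section Singular

open Filter Topology

variable {n m : ℕ}

/-- The matrix of the form `|u|²`. -/
def inputGram (n m : ℕ) : Matrix (Fin n ⊕ Fin m) (Fin n ⊕ Fin m) ℂ := Matrix.fromBlocks 0 0 0 1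

theorem sesq_inputGram (x y : Fin n → ℂ) (u v : Fin m → ℂ) :
    sesq (inputGram n m) (Sum.elim x u) (Sum.elim y v) = star u ⬝ᵥ v := by
  rw [sesq, inputGram, Matrix.fromBlocks_mulVec]
  simp [dotProduct]

theorem form_inputGram_re (x : Fin n → ℂ) (u : Fin m → ℂ) :
    (form (inputGram n m) (Sum.elim x u)).re = ∑ i, ‖u i‖ ^ 2 := by
  rw [form_eq_sesq, sesq_inputGram, star_dotProduct_self_re]

theorem isHermitian_inputGram : (inputGram n m).IsHermitian := by
  rw [Matrix.IsHermitian, inputGram, Matrix.fromBlocks_conjTranspose]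
  simp

theorem isRealMatrix_inputGram : IsRealMatrix (inputGram n m) := by
  rintro (i | i) (j | j)
  · rfl
  · rfl
  · rfl
  · exact IsRealMatrix.one i j

/-- Stabilizing completions of squares for a family of perturbed forms `σ(x, u) + ε |u|²`. -/
structure Regularization (A : Matrix (Fin n) (Fin n) ℂ) (B : Matrix (Fin n) (Fin m) ℂ)
    (Q : Matrix (Fin n ⊕ Fin m) (Fin n ⊕ Fin m) ℂ) (ε : ℕ → ℝ)
    (P : ℕ → Matrix (Fin n) (Fin n) ℂ) (C : ℕ → Matrix (Fin m) (Fin n) ℂ)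
    (D : ℕ → Matrix (Fin m) (Fin m) ℂ) : Prop where
  nonneg : ∀ k, 0 ≤ ε k
  le_one : ∀ k, ε k ≤ 1
  isHermitian : ∀ k, (P k).IsHermitian
  completion : ∀ k, kyp A B (Q + (ε k : ℂ) • inputGram n m) (P k) =
    (Matrix.fromCols (C k) (D k))ᴴ * Matrix.fromCols (C k) (D k)
  kernel : ∀ k, ∀ l : ℂ, ‖l‖ < 1 → ∀ x u, x = l • (A *ᵥ x + B *ᵥ u) →
    C k *ᵥ x + D k *ᵥ u = 0 → x = 0 ∧ u = 0

variable {A : Matrix (Fin n) (Fin n) ℂ} {B : Matrix (Fin n) (Fin m) ℂ}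
  {Q : Matrix (Fin n ⊕ Fin m) (Fin n ⊕ Fin m) ℂ} {ε : ℕ → ℝ}
  {P : ℕ → Matrix (Fin n) (Fin n) ℂ} {C : ℕ → Matrix (Fin m) (Fin n) ℂ}
  {D : ℕ → Matrix (Fin m) (Fin m) ℂ}

namespace Regularization

theorem sesq_completion (R : Regularization A B Q ε P C D) (k : ℕ) (x y : Fin n → ℂ)
    (u v : Fin m → ℂ) :
    star (C k *ᵥ x + D k *ᵥ u) ⬝ᵥ (C k *ᵥ y + D k *ᵥ v) =
      sesq Q (Sum.elim x u) (Sum.elim y v) + ε k * (star u ⬝ᵥ v) + sesq (P k) x y -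
        sesq (P k) (A *ᵥ x + B *ᵥ u) (A *ᵥ y + B *ᵥ v) := by
  have h := congrArg (fun M => sesq M (Sum.elim x u) (Sum.elim y v)) (R.completion k)
  simp only [sesq_kyp, sesq_gram, Matrix.fromCols_mulVec_sumElim, sesq_add, sesq_smul,
    sesq_inputGram] at h
  exact h.symm

theorem dissipation (R : Regularization A B Q ε P C D) (k : ℕ) (x : Fin n → ℂ) (u : Fin m → ℂ) :
    ∑ i, ‖(C k *ᵥ x + D k *ᵥ u) i‖ ^ 2 =
      (form Q (Sum.elim x u)).re + ε k * ∑ i, ‖u i‖ ^ 2 + (form (P k) x).re -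
        (form (P k) (A *ᵥ x + B *ᵥ u)).re := by
  have h := congrArg Complex.re (R.sesq_completion k x x u u)
  rw [star_dotProduct_self_re] at h
  rw [h, star_dotProduct_self]
  simp only [Complex.sub_re, Complex.add_re, Complex.re_ofReal_mul, Complex.ofReal_re,
    form_eq_sesq]

/-- The cost of zero input vanishes when the state block of `Q` does. -/
theorem _root_.KYP.sesq_state_eq_zero (hQ : Q.toBlocks₁₁ = 0) (x y : Fin n → ℂ) :
    sesq Q (Sum.elim x 0) (Sum.elim y 0) = 0 := by
  rw [sesq, ← Matrix.fromBlocks_toBlocks Q, hQ, Matrix.fromBlocks_mulVec]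
  simp [dotProduct]

theorem dissipation_zero_input (R : Regularization A B Q ε P C D) (hQ : Q.toBlocks₁₁ = 0)
    (k : ℕ) (x : Fin n → ℂ) :
    ∑ i, ‖(C k *ᵥ x) i‖ ^ 2 = (form (P k) x).re - (form (P k) (A *ᵥ x)).re := by
  have h := R.dissipation k x 0
  simpa [form_eq_sesq, sesq_state_eq_zero hQ] using h

/-- With zero input and vanishing state cost, the form of `P k` does not increase along trajectories
of the stable matrix `A`, which tend to zero. -/
theorem posSemidef (R : Regularization A B Q ε P C D) (hA : Stable A) (hQ : Q.toBlocks₁₁ = 0)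
    (k : ℕ) : (P k).PosSemidef := by
  refine posSemidef_iff_re.mpr ⟨R.isHermitian k, hA.form_nonneg fun v => ?_⟩
  have h := R.dissipation_zero_input hQ k v
  have h0 : 0 ≤ ∑ i, ‖(C k *ᵥ v) i‖ ^ 2 := by positivity
  linarith

end Regularization

/-- The vectors at which a family of positive semidefinite forms is bounded. -/
def boundedSubspace (P : ℕ → Matrix (Fin n) (Fin n) ℂ) (hP : ∀ k, (P k).PosSemidef) :
    Submodule ℂ (Fin n → ℂ) where
  carrier := {v | ∃ c : ℝ, ∀ k, (form (P k) v).re ≤ c}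
  zero_mem' := ⟨0, fun k => by simp [form]⟩
  add_mem' := by
    rintro v w ⟨c, hc⟩ ⟨d, hd⟩
    refine ⟨2 * c + 2 * d, fun k => ?_⟩
    have h1 := norm_sesq_le (hP k) v w
    have h2 := Complex.re_le_norm (sesq (P k) v w)
    rw [form_add_vec_re (hP k).1]
    linarith [hc k, hd k]
  smul_mem' := by
    rintro a v ⟨c, hc⟩
    refine ⟨‖a‖ ^ 2 * c, fun k => ?_⟩
    rw [form_smul_vec_re]
    exact mul_le_mul_of_nonneg_left (hc k) (by positivity)

namespace Regularization

/-- Start from the zero state: the dissipation identity bounds the form of `P k` at `B u` by the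
cost of `u`, uniformly since `ε k ≤ 1`. -/
theorem input_mem (R : Regularization A B Q ε P C D) (hP : ∀ k, (P k).PosSemidef)
    (u : Fin m → ℂ) : B *ᵥ u ∈ boundedSubspace P hP := by
  refine ⟨(form Q (Sum.elim 0 u)).re + ∑ i, ‖u i‖ ^ 2, fun k => ?_⟩
  have h := R.dissipation k 0 u
  have h0 : 0 ≤ ∑ i, ‖(C k *ᵥ 0 + D k *ᵥ u) i‖ ^ 2 := by positivity
  have h1 : ε k * ∑ i, ‖u i‖ ^ 2 ≤ ∑ i, ‖u i‖ ^ 2 :=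
    mul_le_of_le_one_left (by positivity) (R.le_one k)
  have h2 : form (P k) 0 = 0 := by simp [form]
  rw [h2, Matrix.mulVec_zero, Matrix.mulVec_zero, zero_add, zero_add, Complex.zero_re] at h
  rw [Matrix.mulVec_zero, zero_add] at h0
  linarith

theorem step_mem (R : Regularization A B Q ε P C D) (hQ : Q.toBlocks₁₁ = 0)
    (hP : ∀ k, (P k).PosSemidef) {v : Fin n → ℂ} (hv : v ∈ boundedSubspace P hP) :
    A *ᵥ v ∈ boundedSubspace P hP := by
  obtain ⟨c, hc⟩ := hv
  refine ⟨c, fun k => ?_⟩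
  have h := R.dissipation_zero_input hQ k v
  have h0 : 0 ≤ ∑ i, ‖(C k *ᵥ v) i‖ ^ 2 := by positivity
  linarith [hc k]

theorem norm_output_le (R : Regularization A B Q ε P C D) (hQ : Q.toBlocks₁₁ = 0)
    (hP : ∀ k, (P k).PosSemidef) {v : Fin n → ℂ} (hv : v ∈ boundedSubspace P hP) :
    ∃ c : ℝ, ∀ k i, ‖(C k *ᵥ v) i‖ ≤ c := by
  obtain ⟨c, hc⟩ := hv
  refine ⟨√c, fun k i => Real.le_sqrt_of_sq_le ?_⟩
  have h := R.dissipation_zero_input hQ k v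
  have h0 := (posSemidef_iff_re.mp (hP k)).2 (A *ᵥ v)
  have h1 : ‖(C k *ᵥ v) i‖ ^ 2 ≤ ∑ i, ‖(C k *ᵥ v) i‖ ^ 2 :=
    Finset.single_le_sum (f := fun i => ‖(C k *ᵥ v) i‖ ^ 2) (fun _ _ => by positivity)
      (Finset.mem_univ i)
  linarith [hc k]

theorem norm_feedthrough_le (R : Regularization A B Q ε P C D) (hP : ∀ k, (P k).PosSemidef)
    (u : Fin m → ℂ) : ∃ c : ℝ, ∀ k i, ‖(D k *ᵥ u) i‖ ≤ c := by
  refine ⟨√((form Q (Sum.elim 0 u)).re + ∑ i, ‖u i‖ ^ 2), fun k i => Real.le_sqrt_of_sq_le ?_⟩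
  have h := R.dissipation k 0 u
  have h0 := (posSemidef_iff_re.mp (hP k)).2 (B *ᵥ u)
  have h1 : ε k * ∑ i, ‖u i‖ ^ 2 ≤ ∑ i, ‖u i‖ ^ 2 :=
    mul_le_of_le_one_left (by positivity) (R.le_one k)
  have h2 : form (P k) 0 = 0 := by simp [form]
  have h3 : ‖(D k *ᵥ u) i‖ ^ 2 ≤ ∑ i, ‖(D k *ᵥ u) i‖ ^ 2 :=
    Finset.single_le_sum (f := fun i => ‖(D k *ᵥ u) i‖ ^ 2) (fun _ _ => by positivity)
      (Finset.mem_univ i)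
  rw [h2, Matrix.mulVec_zero, Matrix.mulVec_zero, zero_add, zero_add, Complex.zero_re] at h
  linarith

/-- The output matrices of the family, restricted by `E`. -/
def outputs (E : Matrix (Fin n) (Fin n) ℂ) (C : ℕ → Matrix (Fin m) (Fin n) ℂ)
    (D : ℕ → Matrix (Fin m) (Fin m) ℂ) :
    Set (Matrix (Fin m) (Fin n) ℂ × Matrix (Fin m) (Fin m) ℂ) :=
  Set.range fun k => (C k * E, D k)

theorem _root_.KYP.exists_norm_le_of_columns {ι κ : Type*} [Fintype ι] [Fintype κ]
    [DecidableEq κ] {M : ℕ → Matrix ι κ ℂ}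
    (h : ∀ j, ∃ c : ℝ, ∀ k i, ‖(M k *ᵥ Pi.single j 1) i‖ ≤ c) :
    ∃ c : ℝ, 0 ≤ c ∧ ∀ k i j, ‖M k i j‖ ≤ c := by
  choose c hc using h
  refine ⟨∑ j, |c j|, by positivity, fun k i j => ?_⟩
  have h1 := hc j k i
  rw [Matrix.mulVec_single_one] at h1
  exact (h1.trans (le_abs_self _)).trans (Finset.single_le_sum (f := fun j => |c j|)
    (fun _ _ => abs_nonneg _) (Finset.mem_univ j))

open scoped Matrix.Norms.Elementwise in
-- The matrices `C k` are so far controlled only on the bounded subspace; composing with `E`, whose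
-- range lies there, makes the family bounded.
theorem isCompact_closure_outputs (R : Regularization A B Q ε P C D) (hQ : Q.toBlocks₁₁ = 0)
    (hP : ∀ k, (P k).PosSemidef) {E : Matrix (Fin n) (Fin n) ℂ}
    (hE : ∀ v, E *ᵥ v ∈ boundedSubspace P hP) : IsCompact (closure (outputs E C D)) := by
  obtain ⟨c, hc0, hc⟩ := exists_norm_le_of_columns (M := fun k => C k * E) fun j => by
    obtain ⟨c, hc⟩ := R.norm_output_le hQ hP (hE (Pi.single j 1))
    exact ⟨c, fun k i => by rw [← Matrix.mulVec_mulVec]; exact hc k i⟩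
  obtain ⟨d, hd0, hd⟩ := exists_norm_le_of_columns (M := D) fun j =>
    R.norm_feedthrough_le hP (Pi.single j 1)
  refine Bornology.IsBounded.isCompact_closure (isBounded_iff_forall_norm_le.mpr ⟨max c d, ?_⟩)
  rintro _ ⟨k, rfl⟩
  refine (norm_prod_le_iff).mpr ⟨?_, ?_⟩
  · exact ((Matrix.norm_le_iff hc0).mpr (hc k)).trans (le_max_left _ _)
  · exact ((Matrix.norm_le_iff hd0).mpr (hd k)).trans (le_max_right _ _)

/-- The limit points of the outputs have no zeros inside the unit disc. -/
theorem pencil_det_ne_zero (R : Regularization A B Q ε P C D) (hQ : Q.toBlocks₁₁ = 0)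
    (hP : ∀ k, (P k).PosSemidef) {E : Matrix (Fin n) (Fin n) ℂ}
    (hE : ∀ v, E *ᵥ v ∈ boundedSubspace P hP)
    (hE' : ∀ v ∈ boundedSubspace P hP, E *ᵥ v = v)
    {z : ℂ} (hz : ‖z‖ = 1) (hpos : HarmonicPos A B Q z) {l : ℂ} (hl : ‖l‖ < 1) :
    ∀ p ∈ closure (outputs E C D), (pencil (A * E) B p.1 p.2 l).det ≠ 0 := by
  -- A solution of the state equation automatically lies in the bounded subspace, where `E` acts as
  -- the identity and can be dropped.
  have hfix : ∀ (w : ℂ) x u, x = w • ((A * E) *ᵥ x + B *ᵥ u) → E *ᵥ x = x := by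
    intro w x u hx
    refine hE' x ?_
    rw [hx, ← Matrix.mulVec_mulVec]
    exact Submodule.smul_mem _ _ (Submodule.add_mem _ (R.step_mem hQ hP (hE x))
      (R.input_mem hP u))
  have hz0 : z ≠ 0 := norm_ne_zero_iff.mp (by rw [hz]; exact one_ne_zero)
  refine pencil_det_ne_zero_of_mem_closure (w := z⁻¹) ?_ (by rw [norm_inv, hz, inv_one]) ?_ hl
  · rintro _ ⟨k, rfl⟩ l hl
    refine pencil_det_ne_zero_iff.mpr fun x u hx hu => ?_
    have hEx := hfix l x u hx
    rw [← Matrix.mulVec_mulVec, hEx] at hx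
    rw [← Matrix.mulVec_mulVec, hEx] at hu
    exact R.kernel k l hl x u hx hu
  -- At `w = z⁻¹` a kernel vector is a harmonic motion of frequency `z`, and every member of the
  -- family has squared output at least `σ(x,u)` there. The bound passes to limit points, so zero
  -- output contradicts `hpos`.
  · intro p hp
    refine pencil_det_ne_zero_iff.mpr fun x u hx hu => ?_
    have hEx := hfix z⁻¹ x u hx
    rw [← Matrix.mulVec_mulVec, hEx] at hx
    have hz' : A *ᵥ x + B *ᵥ u = z • x := by
      nth_rewrite 2 [hx]
      rw [smul_inv_smul₀ hz0]
    have hclosed : IsClosed {p : Matrix (Fin m) (Fin n) ℂ × Matrix (Fin m) (Fin m) ℂ |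
        (form Q (Sum.elim x u)).re ≤ ∑ i, ‖(p.1 *ᵥ x + p.2 *ᵥ u) i‖ ^ 2} :=
      isClosed_le continuous_const (by fun_prop)
    have hsub : outputs E C D ⊆ {p : Matrix (Fin m) (Fin n) ℂ × Matrix (Fin m) (Fin m) ℂ |
        (form Q (Sum.elim x u)).re ≤ ∑ i, ‖(p.1 *ᵥ x + p.2 *ᵥ u) i‖ ^ 2} := by
      rintro _ ⟨k, rfl⟩
      change _ ≤ ∑ i, ‖((C k * E) *ᵥ x + D k *ᵥ u) i‖ ^ 2
      rw [← Matrix.mulVec_mulVec, hEx, R.dissipation k x u, hz', form_smul_vec_re, hz]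
      have := mul_nonneg (R.nonneg k) (show 0 ≤ ∑ i, ‖u i‖ ^ 2 by positivity)
      linarith
    have h1 : (form Q (Sum.elim x u)).re ≤ ∑ i, ‖(p.1 *ᵥ x + p.2 *ᵥ u) i‖ ^ 2 :=
      closure_minimal hsub hclosed hp
    rw [hu] at h1
    simp only [Pi.zero_apply, norm_zero, ne_eq, OfNat.ofNat_ne_zero, not_false_eq_true,
      zero_pow, Finset.sum_const_zero] at h1
    by_contra hcon
    exact absurd (hpos x u hz' (mt sum_elim_eq_zero_iff.mp hcon)) (not_lt.mpr h1)

theorem _root_.KYP.exists_projection_matrix (p : Submodule ℂ (Fin n → ℂ)) :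
    ∃ E : Matrix (Fin n) (Fin n) ℂ, (∀ v, E *ᵥ v ∈ p) ∧ ∀ v ∈ p, E *ᵥ v = v := by
  obtain ⟨g, hg⟩ := p.subtype.exists_leftInverse_of_injective p.ker_subtype
  refine ⟨LinearMap.toMatrix' (p.subtype ∘ₗ g), fun v => ?_, fun v hv => ?_⟩
  · rw [LinearMap.toMatrix'_mulVec]
    exact (g v).2
  · rw [LinearMap.toMatrix'_mulVec]
    exact congrArg Subtype.val (LinearMap.congr_fun hg ⟨v, hv⟩)

end Regularization

end Singular

/-! ### Boundedness of the regularized solutions and passage to the limit. -/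

section Limit

open Filter Topology

variable {n m : ℕ} {A : Matrix (Fin n) (Fin n) ℂ} {B : Matrix (Fin n) (Fin m) ℂ}
  {Q : Matrix (Fin n ⊕ Fin m) (Fin n ⊕ Fin m) ℂ} {ε : ℕ → ℝ}
  {P : ℕ → Matrix (Fin n) (Fin n) ℂ} {C : ℕ → Matrix (Fin m) (Fin n) ℂ}
  {D : ℕ → Matrix (Fin m) (Fin m) ℂ}

/-- A stable matrix has an eigenvector modulo each proper invariant subspace. -/
theorem Stable.exists_eigenvector_mod (hA : Stable A) {p : Submodule ℂ (Fin n → ℂ)}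
    (hinv : ∀ v ∈ p, A *ᵥ v ∈ p) (hp : p ≠ ⊤) :
    ∃ (v : Fin n → ℂ) (a : ℂ), v ∉ p ∧ ‖a‖ < 1 ∧ A *ᵥ v - a • v ∈ p := by
  have : Nontrivial ((Fin n → ℂ) ⧸ p) := Submodule.Quotient.nontrivial_iff.mpr hp
  have hinv' : p ≤ p.comap A.mulVecLin := hinv
  obtain ⟨a, ha⟩ := Module.End.exists_eigenvalue (p.mapQ p A.mulVecLin hinv')
  obtain ⟨q, hq⟩ := ha.exists_hasEigenvector
  obtain ⟨v, rfl⟩ := p.mkQ_surjective q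
  have hv : v ∉ p := fun h => hq.2 ((Submodule.Quotient.mk_eq_zero p).mpr h)
  have hmem : A *ᵥ v - a • v ∈ p := by
    have h := hq.apply_eq_smul
    rw [Submodule.mkQ_apply, Submodule.mapQ_apply, ← Submodule.Quotient.mk_smul,
      Submodule.Quotient.eq] at h
    exact h
  refine ⟨v, a, hv, ?_, hmem⟩
  -- If `|a| ≥ 1`, then `A - a` is injective and maps the subspace onto itself. The vector `A v - a
  -- v` then has a preimage inside the subspace, which must be `v`.
  by_contra hcon
  rw [not_lt] at hcon
  let T : (Fin n → ℂ) →ₗ[ℂ] (Fin n → ℂ) := A.mulVecLin - a • LinearMap.id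
  have hT : ∀ w ∈ p, T w ∈ p := fun w hw => p.sub_mem (hinv w hw) (p.smul_mem a hw)
  have hinj : Function.Injective T := by
    refine (injective_iff_map_eq_zero T).mpr fun w hw => hA.eq_zero_of_mulVec_eq hcon ?_
    exact sub_eq_zero.mp hw
  have hTinj : Function.Injective (T.restrict hT) := fun w₁ w₂ h =>
    Subtype.ext (hinj (congrArg Subtype.val h))
  obtain ⟨w, hw⟩ := LinearMap.injective_iff_surjective.mp hTinj ⟨_, hmem⟩
  have hwv : (w : Fin n → ℂ) = v := hinj (congrArg Subtype.val hw)
  exact hv (hwv ▸ w.2)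

theorem sesq_mulVec_right {ι κ μ : Type*} [Fintype ι] [Fintype κ] [Fintype μ] [DecidableEq μ]
    (M : Matrix ι κ ℂ) (T : Matrix κ μ ℂ) (w : ι → ℂ) (h : μ → ℂ) :
    sesq M w (T *ᵥ h) = ∑ i, h i * sesq M w (T *ᵥ Pi.single i 1) := by
  have hT : T *ᵥ h = ∑ i, h i • (T *ᵥ Pi.single i 1) := by
    simp only [← Matrix.mulVec_smul, ← Matrix.mulVec_sum]
    congr 1
    ext j
    simp [Finset.sum_apply, Pi.single_apply]
  rw [hT]
  simp only [sesq, Matrix.mulVec_sum, Matrix.mulVec_smul, dotProduct_sum, dotProduct_smul,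
    smul_eq_mul]

namespace Regularization

/-- Prescribed outputs of the family at a frequency outside the closed disc are produced by
uniformly bounded states and inputs. -/
theorem exists_bounded_response (R : Regularization A B Q ε P C D) (hQ : Q.toBlocks₁₁ = 0)
    (hP : ∀ k, (P k).PosSemidef) {E : Matrix (Fin n) (Fin n) ℂ}
    (hE : ∀ v, E *ᵥ v ∈ boundedSubspace P hP)
    (hE' : ∀ v ∈ boundedSubspace P hP, E *ᵥ v = v)
    {z : ℂ} (hz : ‖z‖ = 1) (hpos : HarmonicPos A B Q z) {l : ℂ} (hl : ‖l‖ < 1)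
    (η : Fin m → ℂ) :
    ∃ (y : ℕ → Fin n → ℂ) (u : ℕ → Fin m → ℂ) (c : ℝ), (∀ k i, ‖Sum.elim (y k) (u k) i‖ ≤ c) ∧
      ∀ k, E *ᵥ y k = y k ∧ y k = l • (A *ᵥ y k + B *ᵥ u k) ∧ C k *ᵥ y k + D k *ᵥ u k = η := by
  have hdet := R.pencil_det_ne_zero hQ hP hE hE' hz hpos hl
  have hcomp := R.isCompact_closure_outputs hQ hP hE
  have hcont : ContinuousOn (fun p : Matrix (Fin m) (Fin n) ℂ × Matrix (Fin m) (Fin m) ℂ =>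
      -- The inverse pencil is continuous on a compact set of nondegenerate outputs, hence bounded
      -- there.
      (pencil (A * E) B p.1 p.2 l)⁻¹ *ᵥ Sum.elim 0 η) (closure (outputs E C D)) := by
    have h1 : ContinuousOn (fun p : Matrix (Fin m) (Fin n) ℂ × Matrix (Fin m) (Fin m) ℂ =>
        (pencil (A * E) B p.1 p.2 l).det⁻¹ • ((pencil (A * E) B p.1 p.2 l).adjugate *ᵥ
          Sum.elim 0 η)) (closure (outputs E C D)) := by
      refine ContinuousOn.smul (ContinuousOn.inv₀ ?_ hdet) (Continuous.continuousOn ?_)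
      · exact (continuous_pencil (A * E) B l).matrix_det.continuousOn
      · exact (continuous_pencil (A * E) B l).matrix_adjugate.matrix_mulVec continuous_const
    refine h1.congr fun p _ => ?_
    rw [Matrix.inv_def, Ring.inverse_eq_inv', Matrix.smul_mulVec]
  obtain ⟨c, hc⟩ := hcomp.exists_bound_of_continuousOn hcont
  have hsol : ∀ k, ∃ y u, (pencil (A * E) B (C k * E) (D k) l)⁻¹ *ᵥ Sum.elim 0 η =
      Sum.elim y u := fun k => exists_sum_elim _
  choose y u hyu using hsol
  refine ⟨y, u, c, fun k i => ?_, fun k => ?_⟩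
  · rw [← hyu]
    exact (norm_le_pi_norm _ i).trans (hc (C k * E, D k) (subset_closure ⟨k, rfl⟩))
  · have hunit : IsUnit (pencil (A * E) B (C k * E) (D k) l).det :=
      (hdet (C k * E, D k) (subset_closure ⟨k, rfl⟩)).isUnit
    have h1 : pencil (A * E) B (C k * E) (D k) l *ᵥ Sum.elim (y k) (u k) =
        Sum.elim (0 : Fin n → ℂ) η := by
      rw [← hyu, Matrix.mulVec_mulVec, Matrix.mul_nonsing_inv _ hunit, Matrix.one_mulVec]
    rw [pencil_mulVec, ← Matrix.mulVec_mulVec, ← Matrix.mulVec_mulVec] at h1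
    have h2 : l • (A *ᵥ E *ᵥ y k + B *ᵥ u k) - y k = 0 :=
      funext fun i => congrFun h1 (Sum.inl i)
    have h3 : C k *ᵥ E *ᵥ y k + D k *ᵥ u k = η := funext fun i => congrFun h1 (Sum.inr i)
    have h4 : E *ᵥ y k = y k := by
      refine hE' _ ?_
      rw [← sub_eq_zero.mp h2]
      exact Submodule.smul_mem _ _ (Submodule.add_mem _ (R.step_mem hQ hP (hE _))
        (R.input_mem hP _))
    rw [h4] at h2 h3
    exact ⟨h4, (sub_eq_zero.mp h2).symm, h3⟩

/-- Duality: component `j` of `C k v` is paired with a bounded response whose output is the `j`-th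
unit vector. -/
theorem exists_output_bound (R : Regularization A B Q ε P C D) (hQ : Q.toBlocks₁₁ = 0)
    (hP : ∀ k, (P k).PosSemidef) {z : ℂ} (hz : ‖z‖ = 1) (hpos : HarmonicPos A B Q z)
    {v : Fin n → ℂ} {a : ℂ} (ha : ‖a‖ < 1) (hv : A *ᵥ v - a • v ∈ boundedSubspace P hP)
    (j : Fin m) : ∃ c : ℝ, ∀ k, ‖(C k *ᵥ v) j‖ ≤ c := by
  obtain ⟨E, hE, hE'⟩ := exists_projection_matrix (boundedSubspace P hP)
  obtain ⟨y, u, c, hc, hyu⟩ := R.exists_bounded_response hQ hP hE hE' hz hpos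
    (l := star a) (by rwa [norm_star]) (Pi.single j 1)
  set w := A *ᵥ v - a • v with hw
  set T : Matrix (Fin n) (Fin n ⊕ Fin m) ℂ := Matrix.fromCols (A * E) B with hT
  have hTmem : ∀ h, T *ᵥ h ∈ boundedSubspace P hP := by
    intro h
    obtain ⟨x, u, rfl⟩ := exists_sum_elim h
    rw [hT, Matrix.fromCols_mulVec_sumElim, ← Matrix.mulVec_mulVec]
    exact Submodule.add_mem _ (R.step_mem hQ hP (hE x)) (R.input_mem hP u)
  have hbd : ∀ i, ∃ d : ℝ, ∀ k, ‖sesq (P k) w (T *ᵥ Pi.single i 1)‖ ≤ d := by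
    intro i
    obtain ⟨d₁, h₁⟩ := hv
    obtain ⟨d₂, h₂⟩ := hTmem (Pi.single i 1)
    refine ⟨(d₁ + d₂) / 2, fun k => ?_⟩
    linarith [norm_sesq_le (hP k) w (T *ᵥ Pi.single i 1), h₁ k, h₂ k]
  choose d hd using hbd
  -- Because `y = conj a (A y + B u)`, the part `a v` of `A v` contributes a term cancelling the
  -- possibly unbounded pairing of `v` with `y` in `P k`. Only `w` and `A y + B u` are left, both in
  -- the bounded subspace.
  have hkey : ∀ k, star ((C k *ᵥ v) j) =
      sesq Q (Sum.elim v 0) (Sum.elim (y k) (u k)) - sesq (P k) w (T *ᵥ Sum.elim (y k) (u k)) := by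
    intro k
    obtain ⟨h1, h2, h3⟩ := hyu k
    have h4 := R.sesq_completion k v (y k) 0 (u k)
    have hTk : T *ᵥ Sum.elim (y k) (u k) = A *ᵥ y k + B *ᵥ u k := by
      rw [hT, Matrix.fromCols_mulVec_sumElim, ← Matrix.mulVec_mulVec, h1]
    have hAv : A *ᵥ v = a • v + w := by rw [hw]; abel
    rw [h3, Matrix.mulVec_zero, Matrix.mulVec_zero, add_zero, add_zero, hAv, sesq_add_left,
      sesq_smul_left, ← sesq_smul_right, ← h2] at h4
    simp only [dotProduct_single_one, star_zero, zero_dotProduct, mul_zero, add_zero,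
      Pi.star_apply] at h4
    rw [h4, hTk]
    ring
  refine ⟨∑ i, c * ‖sesq Q (Sum.elim v 0) (Pi.single i 1)‖ + ∑ i, c * d i, fun k => ?_⟩
  rw [← norm_star, hkey]
  refine (norm_sub_le _ _).trans (add_le_add ?_ ?_)
  · have h1 := sesq_mulVec_right Q 1 (Sum.elim v 0) (Sum.elim (y k) (u k))
    simp only [Matrix.one_mulVec] at h1
    rw [h1]
    refine (norm_sum_le _ _).trans (Finset.sum_le_sum fun i _ => ?_)
    rw [norm_mul]
    exact mul_le_mul_of_nonneg_right (hc k i) (norm_nonneg _)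
  · rw [sesq_mulVec_right]
    refine (norm_sum_le _ _).trans (Finset.sum_le_sum fun i _ => ?_)
    rw [norm_mul]
    exact mul_le_mul (hc k i) (hd i k) (norm_nonneg _) ((norm_nonneg _).trans (hc k i))

/-- At an eigenvector modulo the subspace, the contraction factor `|a|² < 1` in the dissipation
identity bounds `P k` in terms of the bounded quantities `C k v` and `w`. -/
theorem boundedSubspace_eq_top (R : Regularization A B Q ε P C D) (hA : Stable A)
    (hQ : Q.toBlocks₁₁ = 0) (hP : ∀ k, (P k).PosSemidef) {z : ℂ} (hz : ‖z‖ = 1)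
    (hpos : HarmonicPos A B Q z) : boundedSubspace P hP = ⊤ := by
  by_contra hne
  obtain ⟨v, a, hv, ha, hw⟩ := hA.exists_eigenvector_mod
    (fun v hv => R.step_mem hQ hP hv) hne
  refine hv ?_
  choose c hc using fun j => R.exists_output_bound hQ hP hz hpos ha hw j
  obtain ⟨d, hd⟩ := hw
  set w := A *ᵥ v - a • v with hwdef
  -- The cross term is split with weight `τ`, half the gap `1 - |a|²`. It uses up at most `τ` of the
  -- gap and leaves `τ` as coefficient of the form at `v`.
  set τ : ℝ := (1 - ‖a‖ ^ 2) / 2 with hτ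
  have ha2 : ‖a‖ ^ 2 < 1 := pow_lt_one₀ (norm_nonneg _) ha two_ne_zero
  have hτ0 : 0 < τ := by rw [hτ]; linarith
  refine ⟨(∑ j, c j ^ 2 + (1 + τ⁻¹) * d) / τ, fun k => ?_⟩
  rw [le_div_iff₀ hτ0]
  have hH := hP k
  have h1 := R.dissipation_zero_input hQ k v
  have h2 : ∑ j, ‖(C k *ᵥ v) j‖ ^ 2 ≤ ∑ j, c j ^ 2 :=
    Finset.sum_le_sum fun j _ => pow_le_pow_left₀ (norm_nonneg _) (hc j k) 2
  have hAv : A *ᵥ v = a • v + w := by rw [hwdef]; abel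
  rw [hAv, form_add_vec_re hH.1, form_smul_vec_re] at h1
  have hs : (√τ : ℂ) ≠ 0 := by exact_mod_cast (Real.sqrt_pos.mpr hτ0).ne'
  have h3 := norm_sesq_le hH ((√τ : ℂ) • (a • v)) ((√τ : ℂ)⁻¹ • w)
  have h4 : sesq (P k) ((√τ : ℂ) • (a • v)) ((√τ : ℂ)⁻¹ • w) = sesq (P k) (a • v) w := by
    rw [sesq_smul_left, sesq_smul_right, Complex.star_def, Complex.conj_ofReal,
      mul_inv_cancel_left₀ hs]
  have hsq : ‖(√τ : ℂ)‖ ^ 2 = τ := by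
    rw [Complex.norm_real, Real.norm_eq_abs, sq_abs, Real.sq_sqrt hτ0.le]
  rw [h4, form_smul_vec_re, form_smul_vec_re, form_smul_vec_re, norm_inv, inv_pow, hsq] at h3
  have h5 := Complex.re_le_norm (sesq (P k) (a • v) w)
  have h6 := (posSemidef_iff_re.mp hH).2 v
  have h7 : τ⁻¹ * (form (P k) w).re ≤ τ⁻¹ * d :=
    mul_le_mul_of_nonneg_left (hd k) (inv_nonneg.mpr hτ0.le)
  have h8 : τ * (‖a‖ ^ 2 * (form (P k) v).re) ≤ τ * (form (P k) v).re :=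
    mul_le_mul_of_nonneg_left (mul_le_of_le_one_left h6 ha2.le) hτ0.le
  have h9 : (form (P k) v).re * τ = (form (P k) v).re - ‖a‖ ^ 2 * (form (P k) v).re
      - τ * (form (P k) v).re := by
    rw [hτ]; ring
  linarith [hd k]

open scoped Matrix.Norms.Elementwise in
/-- The completions of squares of the perturbed forms accumulate at a stabilizing completion of
squares of the form itself. -/
theorem exists_limit (R : Regularization A B Q ε P C D) (hA : Stable A)
    (hQ : Q.toBlocks₁₁ = 0) {z : ℂ} (hz : ‖z‖ = 1) (hpos : HarmonicPos A B Q z)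
    (hε : Tendsto ε atTop (𝓝 0)) :
    ∃ (P₀ : Matrix (Fin n) (Fin n) ℂ) (C₀ : Matrix (Fin m) (Fin n) ℂ)
      (D₀ : Matrix (Fin m) (Fin m) ℂ), P₀.IsHermitian ∧
      kyp A B Q P₀ = (Matrix.fromCols C₀ D₀)ᴴ * Matrix.fromCols C₀ D₀ ∧
      (∀ l : ℂ, ‖l‖ < 1 → (pencil A B C₀ D₀ l).det ≠ 0) ∧
      ((∀ k, IsRealMatrix (P k) ∧ IsRealMatrix (C k) ∧ IsRealMatrix (D k)) →
        IsRealMatrix P₀ ∧ IsRealMatrix C₀ ∧ IsRealMatrix D₀) := by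
  have hP := R.posSemidef hA hQ
  have htop := R.boundedSubspace_eq_top hA hQ hP hz hpos
  have hmem : ∀ v, v ∈ boundedSubspace P hP := fun v => htop ▸ Submodule.mem_top
  have hE : ∀ v, (1 : Matrix (Fin n) (Fin n) ℂ) *ᵥ v ∈ boundedSubspace P hP := fun v => hmem _
  have hE' : ∀ v ∈ boundedSubspace P hP, (1 : Matrix (Fin n) (Fin n) ℂ) *ᵥ v = v :=
    fun v _ => Matrix.one_mulVec v
  have hcomp := R.isCompact_closure_outputs hQ hP hE
  have hbdd : Bornology.IsBounded (Set.range P) := by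
    choose c hc using fun j => hmem (Pi.single j 1)
    refine isBounded_iff_forall_norm_le.mpr ⟨∑ j, |c j|, ?_⟩
    rintro _ ⟨k, rfl⟩
    refine (Matrix.norm_le_iff (by positivity)).mpr fun i j =>
      (norm_apply_le_trace (hP k) i j).trans ?_
    rw [Matrix.trace, Complex.re_sum]
    refine Finset.sum_le_sum fun j _ => ?_
    rw [Matrix.diag_apply, ← form_single (P k)]
    exact (hc j k).trans (le_abs_self _)
  have : FirstCountableTopology (Matrix (Fin n) (Fin n) ℂ) :=
    inferInstanceAs (FirstCountableTopology (Fin n → Fin n → ℂ))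
  have : FirstCountableTopology (Matrix (Fin m) (Fin n) ℂ) :=
    inferInstanceAs (FirstCountableTopology (Fin m → Fin n → ℂ))
  have : FirstCountableTopology (Matrix (Fin m) (Fin m) ℂ) :=
    inferInstanceAs (FirstCountableTopology (Fin m → Fin m → ℂ))
  obtain ⟨⟨P₀, C₀, D₀⟩, hmem₀, φ, hφ, hlim⟩ :=
    (hbdd.isCompact_closure.prod hcomp).tendsto_subseq (x := fun k => (P k, C k * (1 : Matrix (Fin n) (Fin n) ℂ), D k))
      fun k => ⟨subset_closure ⟨k, rfl⟩, subset_closure ⟨k, rfl⟩⟩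
  rw [nhds_prod_eq, nhds_prod_eq] at hlim
  have hPl : Tendsto (fun k => P (φ k)) atTop (𝓝 P₀) := hlim.fst
  have hCl : Tendsto (fun k => C (φ k)) atTop (𝓝 C₀) := by
    have h : Tendsto (fun k => C (φ k) * (1 : Matrix (Fin n) (Fin n) ℂ)) atTop (𝓝 C₀) := hlim.snd.fst
    simpa only [Matrix.mul_one] using h
  have hDl : Tendsto (fun k => D (φ k)) atTop (𝓝 D₀) := hlim.snd.snd
  have hεl : Tendsto (fun k => (ε (φ k) : ℂ)) atTop (𝓝 0) := by
    have h := (Complex.continuous_ofReal.tendsto 0).comp (hε.comp hφ.tendsto_atTop)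
    simpa only [Function.comp_def, Complex.ofReal_zero] using h
  refine ⟨P₀, C₀, D₀, ?_, ?_, fun l hl => ?_, fun hr => ⟨?_, ?_, ?_⟩⟩
  · exact (isClosed_eq (f := fun M : Matrix (Fin n) (Fin n) ℂ => Mᴴ) (g := id)
      (by fun_prop) continuous_id).mem_of_tendsto hPl
      (Eventually.of_forall fun k => R.isHermitian (φ k))
  · have hc1 : Continuous fun q : Matrix (Fin n) (Fin n) ℂ × ℂ =>
        kyp A B (Q + q.2 • inputGram n m) q.1 := by
      unfold kyp
      fun_prop
    have hc2 : Continuous fun q : Matrix (Fin m) (Fin n) ℂ × Matrix (Fin m) (Fin m) ℂ =>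
        (Matrix.fromCols q.1 q.2)ᴴ * Matrix.fromCols q.1 q.2 := by
      have h : Continuous fun q : Matrix (Fin m) (Fin n) ℂ × Matrix (Fin m) (Fin m) ℂ =>
          Matrix.fromCols q.1 q.2 := by
        refine continuous_matrix fun i j => ?_
        rcases j with j | j
        · exact continuous_fst.matrix_elem i j
        · exact continuous_snd.matrix_elem i j
      exact h.matrix_conjTranspose.matrix_mul h
    have h1 := (hc1.tendsto (P₀, 0)).comp (hPl.prodMk_nhds hεl)
    have h2 := (hc2.tendsto (C₀, D₀)).comp (hCl.prodMk_nhds hDl)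
    have h3 := tendsto_nhds_unique h1 (h2.congr fun k => (R.completion (φ k)).symm)
    simpa only [zero_smul, add_zero] using h3
  · have h := R.pencil_det_ne_zero hQ hP hE hE' hz hpos hl _ hmem₀.2
    simpa only [Matrix.mul_one] using h
  · exact isClosed_isRealMatrix.mem_of_tendsto hPl (Eventually.of_forall fun k => (hr (φ k)).1)
  · exact isClosed_isRealMatrix.mem_of_tendsto hCl (Eventually.of_forall fun k => (hr (φ k)).2.1)
  · exact isClosed_isRealMatrix.mem_of_tendsto hDl (Eventually.of_forall fun k => (hr (φ k)).2.2)

end Regularization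

end Limit

/-! ### Completions of squares for stable systems, and stabilizing feedback. -/

section Existence

open Filter Topology

variable {n m : ℕ} {A : Matrix (Fin n) (Fin n) ℂ} {B : Matrix (Fin n) (Fin m) ℂ}
  {Q : Matrix (Fin n ⊕ Fin m) (Fin n ⊕ Fin m) ℂ}

theorem form_toBlocks₁₁ (M : Matrix (Fin n ⊕ Fin m) (Fin n ⊕ Fin m) ℂ) (x : Fin n → ℂ) :
    form M.toBlocks₁₁ x = form M (Sum.elim x 0) := by
  rw [form, form]
  nth_rewrite 2 [← Matrix.fromBlocks_toBlocks M]
  rw [Matrix.fromBlocks_mulVec]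
  simp [dotProduct]

theorem isHermitian_toBlocks₁₁ {M : Matrix (Fin n ⊕ Fin m) (Fin n ⊕ Fin m) ℂ}
    (hM : M.IsHermitian) : (M.toBlocks₁₁).IsHermitian := by
  ext i j
  exact hM.apply _ _

/-- The contributions of `P` cancel because `|z| = 1`; hence normalising `Q` does not affect
positivity along harmonic motions. -/
theorem form_kyp_re_of_harmonic {P : Matrix (Fin n) (Fin n) ℂ} {z : ℂ} (hz : ‖z‖ = 1)
    {x : Fin n → ℂ} {u : Fin m → ℂ} (h : A *ᵥ x + B *ᵥ u = z • x) :
    (form (kyp A B Q P) (Sum.elim x u)).re = (form Q (Sum.elim x u)).re := by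
  rw [form_kyp, h, Complex.sub_re, Complex.add_re, form_smul_vec_re, hz]
  ring

theorem Stable.stabilizable (hA : Stable A) (B : Matrix (Fin n) (Fin m) ℂ) :
    Stabilizable A B :=
  ⟨0, fun z hz => by simpa using hA z hz⟩

/-- A stabilizing completion of squares of a form which is positive along harmonic motions. -/
theorem exists_completion_of_harmonicPos (hA : Stable A) (hQ : Q.IsHermitian)
    (hpos : ∀ z : ℂ, ‖z‖ = 1 → HarmonicPos A B Q z) :
    ∃ (P : Matrix (Fin n) (Fin n) ℂ) (C : Matrix (Fin m) (Fin n) ℂ)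
      (D : Matrix (Fin m) (Fin m) ℂ), P.IsHermitian ∧
      kyp A B Q P = (Matrix.fromCols C D)ᴴ * Matrix.fromCols C D ∧
      (∀ l : ℂ, ‖l‖ < 1 → ∀ x u, x = l • (A *ᵥ x + B *ᵥ u) → C *ᵥ x + D *ᵥ u = 0 →
        x = 0 ∧ u = 0) ∧
      (IsRealMatrix A → IsRealMatrix B → IsRealMatrix Q →
        IsRealMatrix P ∧ IsRealMatrix C ∧ IsRealMatrix D) := by
  obtain ⟨P, hP, hF, hPr⟩ := exists_kyp_posDef hQ hpos
  obtain ⟨V, C, D, hV, -, hK, hker, hr⟩ := exists_regulator (hA.stabilizable B) hF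
  rw [kyp_kyp, ← sub_eq_add_neg] at hK
  refine ⟨P - V, C, D, hP.sub hV, hK, fun l hl => hker l hl.le, fun h1 h2 h3 => ?_⟩
  obtain ⟨hVr, hCr, hDr⟩ := hr h1 h2 (isRealMatrix_kyp h1 h2 h3 (hPr h1 h2 h3))
  exact ⟨(hPr h1 h2 h3).sub hVr, hCr, hDr⟩

/-- A stabilizing completion of squares for a stable system. -/
theorem exists_completion_of_stable (hA : Stable A) (hQ : Q.IsHermitian)
    (hnn : ∀ z : ℂ, ‖z‖ = 1 → ∀ x u, A *ᵥ x + B *ᵥ u = z • x → 0 ≤ (form Q (Sum.elim x u)).re)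
    {z₀ : ℂ} (hz₀ : ‖z₀‖ = 1) (hpos : HarmonicPos A B Q z₀) :
    ∃ (P : Matrix (Fin n) (Fin n) ℂ) (C : Matrix (Fin m) (Fin n) ℂ)
      (D : Matrix (Fin m) (Fin m) ℂ), P.IsHermitian ∧
      kyp A B Q P = (Matrix.fromCols C D)ᴴ * Matrix.fromCols C D ∧
      (∀ l : ℂ, ‖l‖ < 1 → (pencil A B C D l).det ≠ 0) ∧
      (IsRealMatrix A → IsRealMatrix B → IsRealMatrix Q →
        IsRealMatrix P ∧ IsRealMatrix C ∧ IsRealMatrix D) := by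
  obtain ⟨R, hR, hRH, hRr⟩ := hA.exists_lyapunov (isHermitian_toBlocks₁₁ hQ)
  -- The Lyapunov solution `R` is chosen so that the state block `Q₁₁ - R + AᴴRA` of `S` vanishes.
  set S := kyp A B Q (-R) with hS
  have hSH : S.IsHermitian := isHermitian_kyp hQ hRH.neg
  have hS11 : S.toBlocks₁₁ = 0 := by
    refine ext_form fun x => ?_
    rw [form_toBlocks₁₁, hS, form_kyp, Matrix.mulVec_zero, add_zero, ← form_toBlocks₁₁, ← hR]
    simp only [form_eq_sesq, sesq_sub, sesq_neg, sesq_congr]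
    simp only [sesq, Matrix.zero_mulVec, dotProduct_zero]
    ring
  have hposε : ∀ k : ℕ, ∀ z : ℂ, ‖z‖ = 1 →
      HarmonicPos A B (S + ((1 / ((k : ℝ) + 1) : ℝ) : ℂ) • inputGram n m) z := by
    intro k z hz x u hxu hne
    rw [form_eq_sesq, sesq_add, sesq_smul, Complex.add_re, Complex.re_ofReal_mul, ← form_eq_sesq,
      ← form_eq_sesq, form_inputGram_re, hS, form_kyp_re_of_harmonic hz hxu]
    -- Stability excludes free harmonic motions, so the perturbation by `|u|²` is strictly positive
    -- on every nonzero motion.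
    have hu : u ≠ 0 := by
      rintro rfl
      rw [Matrix.mulVec_zero, add_zero] at hxu
      exact hne (sum_elim_eq_zero_iff.mpr ⟨hA.eq_zero_of_mulVec_eq hz.ge hxu, rfl⟩)
    have h1 := mul_pos (show (0 : ℝ) < 1 / ((k : ℝ) + 1) by positivity) (sum_norm_sq_pos hu)
    linarith [hnn z hz x u hxu]
  have hSεH : ∀ k : ℕ, (S + ((1 / ((k : ℝ) + 1) : ℝ) : ℂ) • inputGram n m).IsHermitian := by
    intro k
    refine hSH.add ?_
    rw [Matrix.IsHermitian, Matrix.conjTranspose_smul, isHermitian_inputGram.eq]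
    congr 1
    exact Complex.conj_ofReal _
  choose P C D hP hK hker hr using fun k =>
    exists_completion_of_harmonicPos hA (hSεH k) (hposε k)
  have hReg : Regularization A B S (fun k : ℕ => 1 / ((k : ℝ) + 1)) P C D :=
    { nonneg := fun k => by positivity
      le_one := fun k => by
        rw [div_le_one (by positivity)]
        linarith [(Nat.cast_nonneg k : (0 : ℝ) ≤ k)]
      isHermitian := hP
      completion := hK
      kernel := hker }
  have hposS : HarmonicPos A B S z₀ := fun x u hxu hne => by
    rw [hS, form_kyp_re_of_harmonic hz₀ hxu]
    exact hpos x u hxu hne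
  obtain ⟨P₀, C₀, D₀, hP₀, hK₀, hdet, hr₀⟩ := hReg.exists_limit hA hS11 hz₀ hposS
    tendsto_one_div_add_atTop_nhds_zero_nat
  rw [hS, kyp_kyp] at hK₀
  refine ⟨-R + P₀, C₀, D₀, hRH.neg.add hP₀, hK₀, hdet, fun h1 h2 h3 => ?_⟩
  have hRr' := hRr h1 (h3.submatrix Sum.inl Sum.inl)
  have hSr : IsRealMatrix S := isRealMatrix_kyp h1 h2 h3 hRr'.neg
  obtain ⟨h4, h5, h6⟩ := hr₀ fun k => hr k h1 h2 (hSr.add (isRealMatrix_inputGram.smul _))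
  exact ⟨hRr'.neg.add h4, h5, h6⟩

/-- A stabilizing feedback gain, real for real data. -/
theorem exists_feedback (hAB : Stabilizable A B) :
    ∃ K : Matrix (Fin m) (Fin n) ℂ, Stable (A + B * K) ∧
      (IsRealMatrix A → IsRealMatrix B → IsRealMatrix K) := by
  obtain ⟨V, C, D, -, hD, -, hker, hr⟩ := exists_regulator hAB
    (Matrix.PosDef.one (n := Fin n ⊕ Fin m) (R := ℂ))
  -- The optimal feedback makes the output `C x + D u` zero. An eigenvector of the closed loop with
  -- `|z| ≥ 1` would be a zero of the system at `z⁻¹` in the closed disc.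
  refine ⟨-(D⁻¹ * C), fun z hz => ?_, fun h1 h2 => ?_⟩
  · refine Matrix.mulVec_injective_iff_isUnit.mp ?_
    refine (injective_iff_map_eq_zero (Matrix.mulVecLin _)).mpr fun x hx => ?_
    rw [Matrix.mulVecLin_apply, Matrix.sub_mulVec, Matrix.smul_mulVec, Matrix.one_mulVec,
      sub_eq_zero, Matrix.add_mulVec, ← Matrix.mulVec_mulVec] at hx
    have hz0 : z ≠ 0 := norm_pos_iff.mp (zero_lt_one.trans_le hz)
    refine (hker z⁻¹ ?_ x (-(D⁻¹ * C) *ᵥ x) ?_ ?_).1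
    · rw [norm_inv]
      exact inv_le_one_of_one_le₀ hz
    · rw [← hx, inv_smul_smul₀ hz0]
    · rw [Matrix.mulVec_mulVec, Matrix.mul_neg, ← Matrix.mul_assoc, Matrix.mul_nonsing_inv _ hD,
        Matrix.one_mul, Matrix.neg_mulVec, add_neg_cancel]
  · obtain ⟨-, hC, hDr⟩ := hr h1 h2 IsRealMatrix.one
    exact ((hDr.inv hD).mul hC).neg

end Existence

/-! ### The frequency condition and the equivalence. -/

section Main

open Filter Topology

variable {n m : ℕ} {A : Matrix (Fin n) (Fin n) ℂ} {B : Matrix (Fin n) (Fin m) ℂ}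
  {Q : Matrix (Fin n ⊕ Fin m) (Fin n ⊕ Fin m) ℂ}

theorem form_Pi (z : ℂ) (u : Fin m → ℂ) :
    form (Pi A B Q z) u =
      form Q (Sum.elim ((z • (1 : Matrix (Fin n) (Fin n) ℂ) - A)⁻¹ *ᵥ (B *ᵥ u)) u) := by
  rw [Pi, form_eq_sesq, sesq_congr, Matrix.fromRows_mulVec, Matrix.one_mulVec,
    ← Matrix.mulVec_mulVec]
  rfl

theorem resolvent_eq_iff {z : ℂ} (hz : (z • (1 : Matrix (Fin n) (Fin n) ℂ) - A).det ≠ 0)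
    {x b : Fin n → ℂ} :
    A *ᵥ x + b = z • x ↔ x = (z • (1 : Matrix (Fin n) (Fin n) ℂ) - A)⁻¹ *ᵥ b := by
  have hmul : (z • (1 : Matrix (Fin n) (Fin n) ℂ) - A) *ᵥ x = z • x - A *ᵥ x := by
    rw [Matrix.sub_mulVec, Matrix.smul_mulVec, Matrix.one_mulVec]
  constructor
  · intro h
    have hb : b = (z • (1 : Matrix (Fin n) (Fin n) ℂ) - A) *ᵥ x := by
      rw [hmul, ← h]
      abel
    rw [hb, Matrix.mulVec_mulVec, Matrix.nonsing_inv_mul _ hz.isUnit, Matrix.one_mulVec]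
  · intro h
    have hb : (z • (1 : Matrix (Fin n) (Fin n) ℂ) - A) *ᵥ x = b := by
      rw [h, Matrix.mulVec_mulVec, Matrix.mul_nonsing_inv _ hz.isUnit, Matrix.one_mulVec]
    rw [← hb, hmul]
    abel

theorem harmonicPos_of_posDef {z : ℂ}
    (hz : (z • (1 : Matrix (Fin n) (Fin n) ℂ) - A).det ≠ 0) (hPi : (Pi A B Q z).PosDef) :
    HarmonicPos A B Q z := by
  intro x u hxu hne
  have hx := (resolvent_eq_iff hz).mp hxu
  have hu : u ≠ 0 := by
    rintro rfl
    rw [Matrix.mulVec_zero, Matrix.mulVec_zero] at hx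
    exact hne (sum_elim_eq_zero_iff.mpr ⟨hx, rfl⟩)
  have h := (posDef_iff_re.mp hPi).2 u hu
  rwa [form_Pi, ← hx] at h

theorem isHermitian_Pi (hQ : Q.IsHermitian) (z : ℂ) : (Pi A B Q z).IsHermitian :=
  Matrix.isHermitian_conjTranspose_mul_mul _ hQ

theorem form_re_eq_of_completion {P : Matrix (Fin n) (Fin n) ℂ} {C : Matrix (Fin m) (Fin n) ℂ}
    {D : Matrix (Fin m) (Fin m) ℂ} (h : IsStabilizingCompletion A B Q P C D) {z : ℂ}
    (hz : ‖z‖ = 1) {x : Fin n → ℂ} {u : Fin m → ℂ} (hxu : A *ᵥ x + B *ᵥ u = z • x) :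
    (form Q (Sum.elim x u)).re = ‖WithLp.toLp 2 (C *ᵥ x + D *ᵥ u)‖ ^ 2 := by
  have h1 := congrArg Complex.re (h.completion x u)
  rw [hxu, Complex.sub_re, Complex.add_re, form_smul_vec_re, hz, Complex.ofReal_re, sigma] at h1
  linarith

/-- A stabilizing completion of squares implies the frequency condition. -/
theorem frequencyCondition_of_completion (hQ : Q.IsHermitian) {P : Matrix (Fin n) (Fin n) ℂ}
    {C : Matrix (Fin m) (Fin n) ℂ} {D : Matrix (Fin m) (Fin m) ℂ}
    (h : IsStabilizingCompletion A B Q P C D) : FrequencyCondition A B Q := by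
  obtain ⟨p, -, hp⟩ := exists_pencil_polynomial A B C D
  have hp0 : p ≠ 0 := by
    rintro rfl
    have h0 := hp 0
    rw [Polynomial.eval_zero] at h0
    exact h.det_ne_zero 0 (by simp) h0.symm
  have hfin₁ : {z : ℂ | (z • (1 : Matrix (Fin n) (Fin n) ℂ) - A).det = 0}.Finite := by
    refine (Polynomial.finite_setOfPred_isRoot A.charpoly_monic.ne_zero).subset fun z hz => ?_
    change A.charpoly.eval z = 0
    rw [Matrix.eval_charpoly, Matrix.scalar_apply, ← Matrix.smul_one_eq_diagonal]
    exact hz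
  have hfin₂ : {z : ℂ | p.eval z⁻¹ = 0}.Finite :=
    (Polynomial.finite_setOfPred_isRoot hp0).preimage inv_injective.injOn
  -- Exceptional frequencies are eigenvalues of `A` or reciprocals of zeros of the system
  -- determinant.
  refine (hfin₁.union hfin₂).subset fun z ⟨hz, hbad⟩ => ?_
  by_contra hcon
  have hdet : (z • (1 : Matrix (Fin n) (Fin n) ℂ) - A).det ≠ 0 := fun h => hcon (Or.inl h)
  have hpz : (pencil A B C D z⁻¹).det ≠ 0 := by
    rw [← hp]
    exact fun h => hcon (Or.inr h)
  refine hbad ⟨hdet, posDef_iff_re.mpr ⟨isHermitian_Pi hQ z, fun u hu => ?_⟩⟩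
  have hz0 : z ≠ 0 := norm_ne_zero_iff.mp (by rw [hz]; exact one_ne_zero)
  have hx := (resolvent_eq_iff (b := B *ᵥ u) hdet).mpr rfl
  rw [form_Pi, form_re_eq_of_completion h hz hx]
  refine pow_pos (norm_pos_iff.mpr fun h0 => hu ?_) 2
  refine (pencil_det_ne_zero_iff.mp hpz _ u ?_ ((WithLp.toLp_eq_zero 2).mp h0)).2
  rw [hx, inv_smul_smul₀ hz0]

/-- Each point of the unit circle is a limit of points of the circle outside a finite set. -/
theorem exists_circle_seq {S : Set ℂ} (hS : S.Finite) {z : ℂ} (hz : ‖z‖ = 1) :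
    ∃ f : ℕ → ℂ, Tendsto f atTop (𝓝 z) ∧ ∀ᶠ k in atTop, ‖f k‖ = 1 ∧ f k ∉ S := by
  have hz0 : z ≠ 0 := norm_ne_zero_iff.mp (by rw [hz]; exact one_ne_zero)
  let f : ℕ → ℂ := fun k => z * Complex.exp (((1 / ((k : ℝ) + 1) : ℝ) : ℂ) * Complex.I)
  have hf : Tendsto f atTop (𝓝 z) := by
    have hc : Continuous fun t : ℝ => z * Complex.exp ((t : ℂ) * Complex.I) := by fun_prop
    have h := (hc.tendsto 0).comp (tendsto_one_div_add_atTop_nhds_zero_nat (𝕜 := ℝ))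
    simpa [Function.comp_def, f] using h
  have hne : ∀ k, f k ≠ z := by
    intro k h
    have h1 : Complex.exp (((1 / ((k : ℝ) + 1) : ℝ) : ℂ) * Complex.I) = 1 :=
      mul_left_cancel₀ hz0 (h.trans (mul_one z).symm)
    have h2 := congrArg Complex.im h1
    rw [Complex.exp_ofReal_mul_I_im, Complex.one_im] at h2
    refine (Real.sin_pos_of_pos_of_lt_pi (by positivity) ?_).ne' h2
    have h3 : 1 / ((k : ℝ) + 1) ≤ 1 := by
      rw [div_le_one (by positivity)]
      linarith [(Nat.cast_nonneg k : (0 : ℝ) ≤ k)]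
    linarith [Real.pi_gt_three]
  refine ⟨f, hf, ?_⟩
  have hopen : (S \ {z})ᶜ ∈ 𝓝 z :=
    ((hS.subset Set.sdiff_subset).isClosed.isOpen_compl).mem_nhds fun h => h.2 rfl
  filter_upwards [hf hopen] with k hk
  refine ⟨?_, fun h => hk ⟨h, hne k⟩⟩
  rw [norm_mul, hz, Complex.norm_exp_ofReal_mul_I, one_mul]

/-- The change of variables `u = K x + v`. -/
def feedback (K : Matrix (Fin m) (Fin n) ℂ) : Matrix (Fin n ⊕ Fin m) (Fin n ⊕ Fin m) ℂ :=
  Matrix.fromBlocks 1 0 K 1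

theorem feedback_mulVec (K : Matrix (Fin m) (Fin n) ℂ) (x : Fin n → ℂ) (v : Fin m → ℂ) :
    feedback K *ᵥ Sum.elim x v = Sum.elim x (K *ᵥ x + v) := by
  simp [feedback, Matrix.fromBlocks_mulVec]

theorem form_feedback (K : Matrix (Fin m) (Fin n) ℂ) (x : Fin n → ℂ) (v : Fin m → ℂ) :
    form ((feedback K)ᴴ * Q * feedback K) (Sum.elim x v) = form Q (Sum.elim x (K *ᵥ x + v)) := by
  rw [form_eq_sesq, sesq_congr, feedback_mulVec, form_eq_sesq]

theorem isRealMatrix_feedback {K : Matrix (Fin m) (Fin n) ℂ} (hK : IsRealMatrix K) :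
    IsRealMatrix (feedback K) := by
  rintro (i | i) (j | j)
  · exact IsRealMatrix.one i j
  · rfl
  · exact hK i j
  · exact IsRealMatrix.one i j

theorem HarmonicPos.feedback (K : Matrix (Fin m) (Fin n) ℂ) {z : ℂ} (h : HarmonicPos A B Q z) :
    HarmonicPos (A + B * K) B ((KYP.feedback K)ᴴ * Q * KYP.feedback K) z := by
  intro x v hxv hne
  rw [form_feedback]
  refine h x _ ?_ fun h0 => hne ?_
  · rw [← hxv, Matrix.mulVec_add, Matrix.add_mulVec, Matrix.mulVec_mulVec, add_assoc]
  · obtain ⟨rfl, h1⟩ := sum_elim_eq_zero_iff.mp h0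
    rw [Matrix.mulVec_zero, zero_add] at h1
    exact sum_elim_eq_zero_iff.mpr ⟨rfl, h1⟩

/-- Positivity along harmonic motions of almost all frequencies gives nonnegativity for all. -/
theorem form_nonneg_of_harmonicPos (hA : Stable A) {S : Set ℂ} (hS : S.Finite)
    (hpos : ∀ z : ℂ, ‖z‖ = 1 → z ∉ S → HarmonicPos A B Q z) {z : ℂ} (hz : ‖z‖ = 1)
    {x : Fin n → ℂ} {u : Fin m → ℂ} (hxu : A *ᵥ x + B *ᵥ u = z • x) :
    0 ≤ (form Q (Sum.elim x u)).re := by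
  -- The input `u` is kept fixed while the frequency varies: stability makes the resolvent, and
  -- hence the state, continuous on the circle.
  obtain ⟨f, hf, hfS⟩ := exists_circle_seq hS hz
  have hdet : ∀ w : ℂ, ‖w‖ = 1 → (w • (1 : Matrix (Fin n) (Fin n) ℂ) - A).det ≠ 0 := fun w hw =>
    ((Matrix.isUnit_iff_isUnit_det _).mp (hA w hw.ge)).ne_zero
  have hcont : ContinuousAt (fun w : ℂ => (form Q (Sum.elim
      ((w • (1 : Matrix (Fin n) (Fin n) ℂ) - A)⁻¹ *ᵥ (B *ᵥ u)) u)).re) z := by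
    have h1 : ContinuousAt (fun w : ℂ =>
        (w • (1 : Matrix (Fin n) (Fin n) ℂ) - A)⁻¹ *ᵥ (B *ᵥ u)) z := by
      have hc : Continuous fun w : ℂ => w • (1 : Matrix (Fin n) (Fin n) ℂ) - A := by fun_prop
      have h2 : ContinuousAt (fun w : ℂ => (w • (1 : Matrix (Fin n) (Fin n) ℂ) - A).det⁻¹ •
          ((w • (1 : Matrix (Fin n) (Fin n) ℂ) - A).adjugate *ᵥ (B *ᵥ u))) z :=
        (hc.matrix_det.continuousAt.inv₀ (hdet z hz)).smul
          (hc.matrix_adjugate.matrix_mulVec continuous_const).continuousAt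
      refine h2.congr (Eventually.of_forall fun w => ?_)
      change _ = (w • (1 : Matrix (Fin n) (Fin n) ℂ) - A)⁻¹ *ᵥ (B *ᵥ u)
      rw [Matrix.inv_def, Ring.inverse_eq_inv', Matrix.smul_mulVec]
    have h3 : Continuous fun y : Fin n → ℂ => (form Q (Sum.elim y u)).re := by
      have h4 : Continuous fun y : Fin n → ℂ => (Sum.elim y u : Fin n ⊕ Fin m → ℂ) := by
        refine continuous_pi fun i => ?_
        rcases i with i | i
        · exact continuous_apply i
        · exact continuous_const
      unfold form
      fun_prop
    exact h3.continuousAt.comp h1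
  have hlim := hcont.tendsto.comp hf
  rw [← (resolvent_eq_iff (hdet z hz)).mp hxu] at hlim
  refine ge_of_tendsto hlim ?_
  filter_upwards [hfS] with k hk
  rw [Function.comp_apply]
  have h5 := (resolvent_eq_iff (b := B *ᵥ u) (hdet (f k) hk.1)).mpr rfl
  rcases eq_or_ne (Sum.elim ((f k • (1 : Matrix (Fin n) (Fin n) ℂ) - A)⁻¹ *ᵥ (B *ᵥ u)) u) 0
    with h0 | h0
  · rw [h0]
    simp [form]
  · exact (hpos (f k) hk.1 hk.2 _ u h5 h0).le

/-- The frequency condition implies the existence of a stabilizing completion of squares. -/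
theorem exists_completion_of_frequencyCondition (hAB : Stabilizable A B) (hQ : Q.IsHermitian)
    (hfreq : FrequencyCondition A B Q) :
    ∃ (P : Matrix (Fin n) (Fin n) ℂ) (C : Matrix (Fin m) (Fin n) ℂ)
      (D : Matrix (Fin m) (Fin m) ℂ), IsStabilizingCompletion A B Q P C D ∧
      (IsRealMatrix A → IsRealMatrix B → IsRealMatrix Q →
        IsRealMatrix P ∧ IsRealMatrix C ∧ IsRealMatrix D) := by
  obtain ⟨K, hK, hKr⟩ := exists_feedback hAB
  have hpos : ∀ z : ℂ, ‖z‖ = 1 → z ∉ {z : ℂ | ‖z‖ = 1 ∧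
      ¬ ((z • (1 : Matrix (Fin n) (Fin n) ℂ) - A).det ≠ 0 ∧ (Pi A B Q z).PosDef)} →
      HarmonicPos (A + B * K) B ((feedback K)ᴴ * Q * feedback K) z := by
    intro z hz hzS
    have h : (z • (1 : Matrix (Fin n) (Fin n) ℂ) - A).det ≠ 0 ∧ (Pi A B Q z).PosDef := by
      by_contra hcon
      exact hzS ⟨hz, hcon⟩
    exact (harmonicPos_of_posDef h.1 h.2).feedback K
  -- Besides nonnegativity everywhere, a single frequency of strict positivity suffices; the base
  -- point `1` is arbitrary.
  obtain ⟨f, -, hf⟩ := exists_circle_seq hfreq (z := 1) norm_one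
  obtain ⟨k, hk⟩ := hf.exists
  obtain ⟨P, C, D, hP, hkyp, hdet, hr⟩ := exists_completion_of_stable hK
    (Matrix.isHermitian_conjTranspose_mul_mul (feedback K) hQ)
    (fun z hz x u hxu => form_nonneg_of_harmonicPos hK hfreq hpos hz hxu) hk.1
    (hpos (f k) hk.1 hk.2)
  have hstep : ∀ (x : Fin n → ℂ) (u : Fin m → ℂ),
      (A + B * K) *ᵥ x + B *ᵥ (u - K *ᵥ x) = A *ᵥ x + B *ᵥ u := by
    intro x u
    rw [Matrix.add_mulVec, Matrix.mulVec_sub, Matrix.mulVec_mulVec]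
    abel
  have hout : ∀ (x : Fin n → ℂ) (u : Fin m → ℂ),
      C *ᵥ x + D *ᵥ (u - K *ᵥ x) = (C - D * K) *ᵥ x + D *ᵥ u := by
    intro x u
    rw [Matrix.sub_mulVec, Matrix.mulVec_sub, Matrix.mulVec_mulVec]
    abel
  -- The feedback is undone by substituting `v = u - K x`, which turns `C` into `C - D K` and leaves
  -- `P` and `D` unchanged.
  refine ⟨P, C - D * K, D, ⟨hP, fun x u => ?_, fun l hl => ?_⟩, fun h1 h2 h3 => ?_⟩
  · have h := congrArg (fun M => form M (Sum.elim x (u - K *ᵥ x))) hkyp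
    simp only [form_kyp, form_feedback, form_gram_fromCols, hstep, hout] at h
    rw [add_sub_cancel] at h
    rw [sigma, EuclideanSpace.norm_sq_eq]
    exact h
  · change (pencil A B (C - D * K) D l).det ≠ 0
    refine pencil_det_ne_zero_iff.mpr fun x u hx hu => ?_
    rw [← hstep] at hx
    rw [← hout] at hu
    obtain ⟨rfl, h0⟩ := pencil_det_ne_zero_iff.mp (hdet l hl) x (u - K *ᵥ x) hx hu
    rw [Matrix.mulVec_zero, sub_zero] at h0
    exact ⟨rfl, h0⟩
  · have hKr' := hKr h1 h2
    have hT := isRealMatrix_feedback hKr'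
    obtain ⟨h4, h5, h6⟩ := hr (h1.add (h2.mul hKr')) h2 ((hT.conjTranspose.mul h3).mul hT)
    exact ⟨h4, h5.sub (h6.mul hKr'), h6⟩

end Main

end KYP

theorem mainTheorem1 {n m : ℕ}
    (A : Matrix (Fin n) (Fin n) ℂ) (B : Matrix (Fin n) (Fin m) ℂ)
    (hAB : KYP.Stabilizable A B)
    (Q : Matrix (Fin n ⊕ Fin m) (Fin n ⊕ Fin m) ℂ) (hQ : Q.IsHermitian) :
    ((∃ (P : Matrix (Fin n) (Fin n) ℂ) (C : Matrix (Fin m) (Fin n) ℂ)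
        (D : Matrix (Fin m) (Fin m) ℂ), KYP.IsStabilizingCompletion A B Q P C D) ↔
      KYP.FrequencyCondition A B Q) ∧
    (KYP.IsRealMatrix A → KYP.IsRealMatrix B → KYP.IsRealMatrix Q →
      KYP.FrequencyCondition A B Q →
      ∃ (P : Matrix (Fin n) (Fin n) ℂ) (C : Matrix (Fin m) (Fin n) ℂ)
        (D : Matrix (Fin m) (Fin m) ℂ),
        KYP.IsRealMatrix P ∧ KYP.IsRealMatrix C ∧ KYP.IsRealMatrix D ∧
          KYP.IsStabilizingCompletion A B Q P C D) := by
  refine ⟨⟨?_, fun h => ?_⟩, fun hA hB hQr h => ?_⟩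
  · rintro ⟨P, C, D, h⟩
    exact KYP.frequencyCondition_of_completion hQ h
  · obtain ⟨P, C, D, hc, -⟩ := KYP.exists_completion_of_frequencyCondition hAB hQ h
    exact ⟨P, C, D, hc⟩
  · obtain ⟨P, C, D, hc, hr⟩ := KYP.exists_completion_of_frequencyCondition hAB hQ h
    obtain ⟨h1, h2, h3⟩ := hr hA hB hQr
    exact ⟨P, C, D, h1, h2, h3, hc⟩
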